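/- Let $N>M\ge 0$ be integers. Each user caches $M$ of the $N$ packets $l_1,\dots,l_N$; for every $M$-subset $S$ of $\{1,\dots,N\}$ let $p_S\ge 0$, $\sum_S p_S=1$, be the fraction of users whose cache is $\{l_j: j\in S\}$, and put $q_{S,j}=1$ if $j\in S$ and $q_{S,j}=0$ otherwise. Packet $l_j$ is requested with probability $f_j$, $\sum_j f_j=1$, and $\alpha_j=\frac{\sum_S p_S(1-q_{S,j})f_j}{\sum_{k}\sum_S p_S(1-q_{S,k})f_k}$ is the fraction of base stations that transmit $l_j$. Base stations form a homogeneous Poisson point process in $\mathbb R^2$ with density $\lambda_b>0$. A typical user at the origin is served by the nearest base station, at distance $R$. Every base station has a Rayleigh fading coefficient $h$ with $\mathbb E|h|^2=1$ to the user, and every interfering base station transmits a packet drawn from $(\alpha_j)$, all of these being independent of each other and of the locations. A base station at distance $d$ is received with power $P|h|^2d^{-\beta}$, where $P>0$ and $\beta>2$. A user with cache $S$ cancels the interference of the base stations within distance $R_b$ that transmit a packet with index in $S$; so its residual interference $I_S$ is the total power received from the base stations at distance $>\max\{R,R_b\}$ that transmit a packet with index in $S$ and from those at distance $>R$ that transmit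 another packet. With noise power $\sigma^2>0$ and the serving fading coefficient $h_0$, let $\mathrm{SINR}_S=\frac{P|h_0|^2R^{-\beta}}{I_S+\sigma^2}$. For packet length $T>0$, slot duration $\tau>0$ and bandwidth $B>0$, the loss rate of a packet not cached by the user is $\mathcal P_{l,S}=\mathbb P[\tau B\log_2(1+\mathrm{SINR}_S)<T]$, a cached packet is never lost, and the network-average packet loss rate is $\mathcal P(R_b,\sigma^2)=\sum_S p_S\sum_{j=1}^N(1-q_{S,j})\,\mathcal P_{l,S}\,f_j$. Put $\bar T=2^{T/(\tau B)}-1$ and $\mathcal Z_1(x)=\frac{2x}{\beta-2}\,{}_2F_1\!\left(1,1-\tfrac2\beta;2-\tfrac2\beta;-x\right)$, where ${}_2F_1$ is the Gauss hypergeometric function (analytically continued, i.e. given by Euler's integral), and let $\mathcal Z_1^{-1}(x)=1/\mathcal Z_1(x)$. Assume that the caching probabilities are uniform, $\sum_S p_S q_{S,j}=\frac MN$ for all $j$, and that all packets are equally popular, $f_j=\frac1N$. Then, with global channel knowledge and vanishing noise, whatever the $p_S$ satisfying these conditions, $$\lim_{R_b\to\infty,\ \sigma^2\to0^+}\mathcal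 P(R_b,\sigma^2)=\frac{\left(1-\frac MN\right)^2}{\left[1+\mathcal Z_1^{-1}(\bar T)\right]-\frac MN}.$$ -/

import Mathlib

open MeasureTheory ProbabilityTheory Filter Topology
open scoped ENNReal

noncomputable section

namespace CacheNet

/-! ### Poisson point processes and Rayleigh fading -/

/-- The random points `X 0, X 1, …` (counted with multiplicity) form a Poisson point process with
intensity measure `Λ` on `E`: for pairwise disjoint measurable sets `A 0, …, A (m - 1)` of finite
intensity, the numbers of points in these sets are independent, and the number of points in `A i` is
Poisson distributed with mean `Λ (A i)`. -/
structure IsPoissonProcess {Ω E : Type*} [MeasurableSpace Ω] [MeasurableSpace E]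
    (μ : Measure Ω) (X : ℕ → Ω → E) (Λ : Measure E) : Prop where
  measurable : ∀ n, Measurable (X n)
  law_counts : ∀ (m : ℕ) (A : Fin m → Set E) (k : Fin m → ℕ),
    (∀ i, MeasurableSet (A i)) → Pairwise (fun i j => Disjoint (A i) (A j)) →
    (∀ i, Λ (A i) ≠ ∞) →
    μ {ω | ∀ i, {n | X n ω ∈ A i}.encard = (k i : ℕ∞)}
      = ∏ i, poissonMeasure (Λ (A i)).toNNReal {k i}

/-- The Rayleigh distribution with unit second moment (the law of the modulus of a fading
coefficient with average unit power): density `2 a exp (-a²)` on `a > 0`. -/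
def rayleighUnit : Measure ℝ :=
  (volume.restrict (Set.Ioi 0)).withDensity
    (fun a => ENNReal.ofReal (2 * a * Real.exp (-a ^ 2)))

/-! ### Caching and requests -/

/-- The caching schemes, equivalently the user subsets: the choices of `M` of the `N` packets. -/
abbrev Scheme (N M : ℕ) : Type := {S : Finset (Fin N) // S.card = M}

/-- `cached S j` is `1` if the users of subset `S` have cached packet `j`, and `0` otherwise. -/
def cached {N M : ℕ} (S : Scheme N M) (j : Fin N) : ℝ := if j ∈ S.1 then 1 else 0

/-- The average caching probability `q_j` of packet `j`; `p S` is the fraction of users in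
subset `S`. -/
def cachingProb {N M : ℕ} (p : Scheme N M → ℝ) (j : Fin N) : ℝ := ∑ S, p S * cached S j

/-- The fraction `α_j` of base stations that transmit packet `j` in a slot: the share of packet `j`
among all requests sent to the base stations; `f j` is the popularity of packet `j`. -/
def txProb {N M : ℕ} (p : Scheme N M → ℝ) (f : Fin N → ℝ) (j : Fin N) : ℝ :=
  (∑ S, p S * (1 - cached S j) * f j) / ∑ k, ∑ S, p S * (1 - cached S k) * f k

/-! ### The downlink seen by the typical user at the origin -/

/-- The random downlink network around the typical user at the origin of the plane:
the base stations `X n` form a homogeneous Poisson point process with density `lam`; base station `n`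
has fading modulus `H n` to the user (unit-power Rayleigh), and would transmit packet `J n`,
drawn with probabilities `α`; all fading moduli and packets are independent of each other and of the
locations. -/
structure IsDownlink {Ω : Type*} [MeasurableSpace Ω] {N : ℕ} (μ : Measure Ω)
    (lam : ℝ) (α : Fin N → ℝ) (X : ℕ → Ω → EuclideanSpace ℝ (Fin 2)) (H : ℕ → Ω → ℝ)
    (J : ℕ → Ω → Fin N) : Prop where
  poisson : IsPoissonProcess μ X (ENNReal.ofReal lam • volume)
  measurable_fading : ∀ n, Measurable (H n)
  measurable_packet : ∀ n, Measurable (J n)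
  law_fading : ∀ n, μ.map (H n) = rayleighUnit
  law_packet : ∀ n j, μ.real {ω | J n ω = j} = α j
  indep_fading_packet : ∀ n, IndepFun (H n) (J n) μ
  indep_stations : iIndepFun (fun n ω => (H n ω, J n ω)) μ
  indep_locations : IndepFun (fun ω n => X n ω) (fun ω n => (H n ω, J n ω)) μ

/-- The index of the serving (nearest) base station. -/
def servingIndex (x : ℕ → EuclideanSpace ℝ (Fin 2)) : ℕ := sInf {n | ∀ m, ‖x n‖ ≤ ‖x m‖}

/-- The distance `R` from the user to its serving base station. -/
def servingDist (x : ℕ → EuclideanSpace ℝ (Fin 2)) : ℝ := ‖x (servingIndex x)‖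

/-- The power received from a station at distance `d` with fading modulus `h`, for transmit power
`P` and path-loss exponent `β`. -/
def rxPower (P β d h : ℝ) : ℝ := P * h ^ 2 * d ^ (-β)

/-- The residual interference after cancellation, for a user that has cached the packets in `S` and
knows the channels of the stations up to distance `Rb`: stations transmitting a cached packet
interfere from outside radius `max R Rb`, the other ones from outside radius `R`. -/
def interference {N : ℕ} (P β Rb : ℝ) (S : Finset (Fin N))
    (x : ℕ → EuclideanSpace ℝ (Fin 2)) (h : ℕ → ℝ) (t : ℕ → Fin N) : ℝ≥0∞ :=
  ∑' n, if (if t n ∈ S then max (servingDist x) Rb else servingDist x) < ‖x n‖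
    then ENNReal.ofReal (rxPower P β ‖x n‖ (h n)) else 0

/-- The signal-to-interference-plus-noise ratio of the typical user, for noise power `s2 > 0`
(it is `0` if the interference is infinite). -/
def sinr {N : ℕ} (P β Rb s2 : ℝ) (S : Finset (Fin N))
    (x : ℕ → EuclideanSpace ℝ (Fin 2)) (h : ℕ → ℝ) (t : ℕ → Fin N) : ℝ :=
  (ENNReal.ofReal (rxPower P β (servingDist x) (h (servingIndex x))) /
    (interference P β Rb S x h t + ENNReal.ofReal s2)).toReal

/-- The packet loss rate of the users in subset `S` for un-cached packets: the probability that
a packet of length `T` cannot be transmitted completely in a slot of duration `τ` over the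
bandwidth `B`. -/
def lossRate {Ω : Type*} [MeasurableSpace Ω] {N M : ℕ} (μ : Measure Ω)
    (X : ℕ → Ω → EuclideanSpace ℝ (Fin 2)) (H : ℕ → Ω → ℝ) (J : ℕ → Ω → Fin N)
    (P β T τ B Rb s2 : ℝ) (S : Scheme N M) : ℝ :=
  μ.real {ω | τ * B * Real.logb 2
    (1 + sinr P β Rb s2 S.1 (fun n => X n ω) (fun n => H n ω) (fun n => J n ω)) < T}

/-- The average packet loss rate over all users of the network and all requested packets; requests
for cached packets are never lost. -/
def avgLossRate {Ω : Type*} [MeasurableSpace Ω] {N M : ℕ} (μ : Measure Ω)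
    (X : ℕ → Ω → EuclideanSpace ℝ (Fin 2)) (H : ℕ → Ω → ℝ) (J : ℕ → Ω → Fin N)
    (p : Scheme N M → ℝ) (f : Fin N → ℝ) (P β T τ B Rb s2 : ℝ) : ℝ :=
  ∑ S, p S * ∑ j, (1 - cached S j) * lossRate μ X H J P β T τ B Rb s2 S * f j

/-! ### The closed form -/

/-- The Gauss hypergeometric function `₂F₁(a, b; c; z)` for real `c > b > 0` and `z < 1`, given by
Euler's integral (the power series diverges for `z < -1`). -/
def gaussHyp (a b c z : ℝ) : ℝ :=
  Real.Gamma c / (Real.Gamma b * Real.Gamma (c - b)) *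
    ∫ t in (0 : ℝ)..1, t ^ (b - 1) * (1 - t) ^ (c - b - 1) * (1 - z * t) ^ (-a)

/-- `Z₁(x) = (2 x / (β - 2)) ₂F₁(1, 1 - 2/β; 2 - 2/β; -x)`. -/
def Z₁ (β x : ℝ) : ℝ :=
  2 * x / (β - 2) * gaussHyp 1 (1 - 2 / β) (2 - 2 / β) (-x)

/-- The SINR threshold `2 ^ (T / (τ B)) - 1`. -/
def threshold (T τ B : ℝ) : ℝ := 2 ^ (T / (τ * B)) - 1

end CacheNet

end

/-!
In a slot, a user fails to receive an uncached packet when the SINR falls below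
`s = threshold T τ B`. The squared modulus of Rayleigh fading is exponentially distributed, so, given
the locations and all other marks, the packet gets through with probability
`exp (-(s R ^ β / P) (I + s2))` (`measure_le_sq_of_indepFun`, `le_sinr_iff`). This factorizes over the
stations. Averaging over fading and packets, a station at distance `d > R` contributes the factor
`1 - π θ / (1 + θ)`, where `θ = s (R / d) ^ β` and `π` is the probability that its packet is not
cancelled (`IsDownlink.measure_le_sinr`). As `Rb → ∞` and `s2 → 0`, dominated convergence leaves
`π = ρ`, the probability that a station transmits a packet the user has not cached
(`IsDownlink.tendsto_residualAttenuation`); domination holds because `∑ d ^ (-β)` over the stations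
beyond any positive distance is almost surely finite.

It remains to average the product over a Poisson process. In the coordinate `π lam ‖x‖²` the
stations form a unit-rate process on the half-line (`map_area_volume`), and the factors depend only
on ratios of coordinates. If `u` is the coordinate of the nearest station, the farther ones contribute
`exp (-u ρ κ)` on average with `κ = ∫_1^∞ s / (s + v ^ (β / 2)) dv`, and `u` is exponentially
distributed, so the success probability is `∫_0^∞ exp (-u) exp (-u ρ κ) du = 1 / (1 + ρ κ)`. As a
Poisson process is only known here through the joint law of its counts, conditioning on the nearest
point is replaced by a discretization: the half-line is cut into shells of width `δ`, the product is
bounded above and below on the event that the nearest point lies in a given shell by functionals that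
the Laplace functional (`IsPoissonProcess.lintegral_expNeg_tsum`) evaluates, the resulting geometric
series are summed, and `δ → 0` (`IsPoissonProcess.lintegral_totalAttenuation`).

The substitution `v = t ^ (-2 / β)` in Euler's integral gives `κ = Z₁ β s` (`Z₁_eq_blockRate`). For
uniform caching of equally popular packets, all packets are transmitted equally often, so that
`ρ = 1 - M / N`, and averaging over the requests gives one more factor `1 - M / N`.
-/

namespace CacheNet

/-! ### The exponential `e^{-y}` of an extended nonnegative number -/

/-- `e^{-y}` for `y ∈ [0, ∞]`, with `e^{-∞} = 0`. -/
noncomputable def expNeg (y : ℝ≥0∞) : ℝ≥0∞ := (EReal.exp (y : EReal))⁻¹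

@[simp] lemma expNeg_zero : expNeg 0 = 1 := by simp [expNeg]

@[simp] lemma expNeg_top : expNeg ∞ = 0 := by simp [expNeg]

lemma expNeg_ofReal {y : ℝ} (hy : 0 ≤ y) :
    expNeg (ENNReal.ofReal y) = ENNReal.ofReal (Real.exp (-y)) := by
  rw [expNeg, EReal.coe_ennreal_ofReal, max_eq_left hy, EReal.exp_coe, Real.exp_neg,
    ENNReal.ofReal_inv_of_pos (Real.exp_pos y)]

lemma expNeg_add (y z : ℝ≥0∞) : expNeg (y + z) = expNeg y * expNeg z := by
  have h : ∀ w : ℝ≥0∞, EReal.exp (w : EReal) ≠ 0 := fun w => by simp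
  rw [expNeg, EReal.coe_ennreal_add, EReal.exp_add,
    ENNReal.mul_inv (Or.inl (h y)) (Or.inr (h z))]
  rfl

lemma expNeg_antitone : Antitone expNeg := fun y z h => by
  unfold expNeg
  gcongr
  exact EReal.coe_ennreal_le_coe_ennreal_iff.2 h

lemma expNeg_le_one (y : ℝ≥0∞) : expNeg y ≤ 1 := expNeg_zero ▸ expNeg_antitone zero_le

lemma expNeg_ne_top (y : ℝ≥0∞) : expNeg y ≠ ∞ :=
  ne_top_of_le_ne_top ENNReal.one_ne_top (expNeg_le_one y)

lemma continuous_expNeg : Continuous expNeg :=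
  continuous_inv.comp (ENNReal.continuous_exp.comp continuous_coe_ennreal_ereal)

@[fun_prop] lemma measurable_expNeg : Measurable expNeg := continuous_expNeg.measurable

lemma expNeg_mul_natCast (y : ℝ≥0∞) (n : ℕ) : expNeg (y * n) = expNeg y ^ n := by
  induction n with
  | zero => simp
  | succ n ih => rw [Nat.cast_succ, mul_add, mul_one, expNeg_add, ih, pow_succ]

lemma expNeg_sum {ι : Type*} (s : Finset ι) (y : ι → ℝ≥0∞) :
    expNeg (∑ i ∈ s, y i) = ∏ i ∈ s, expNeg (y i) := by
  classical
  induction s using Finset.induction_on with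
  | empty => simp
  | insert i s hi ih => rw [Finset.sum_insert hi, Finset.prod_insert hi, expNeg_add, ih]

lemma one_sub_expNeg_le (y : ℝ≥0∞) : 1 - expNeg y ≤ y := by
  by_cases h : y = ∞
  · simp [h]
  · lift y to NNReal using h
    rw [← ENNReal.ofReal_coe_nnreal, expNeg_ofReal y.coe_nonneg, ← ENNReal.ofReal_one,
      ← ENNReal.ofReal_sub _ (Real.exp_pos _).le]
    exact ENNReal.ofReal_le_ofReal (by linarith [Real.add_one_le_exp (-(y : ℝ))])

/-! ### The Laplace functional of a Poisson process -/

/-- The generating function of the Poisson distribution. -/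
lemma lintegral_expNeg_mul_poissonMeasure (r : NNReal) (z : ℝ≥0∞) :
    ∫⁻ n, expNeg (z * (n : ℕ)) ∂(poissonMeasure r) = expNeg (r * (1 - expNeg z)) := by
  obtain ⟨q, hq⟩ : ∃ q : ℝ, q = (expNeg z).toReal := ⟨_, rfl⟩
  have hz : expNeg z = ENNReal.ofReal q := by rw [hq, ENNReal.ofReal_toReal (expNeg_ne_top z)]
  have hq0 : 0 ≤ q := hq ▸ ENNReal.toReal_nonneg
  have hq1 : q ≤ 1 := by
    rw [hq]; exact ENNReal.toReal_le_of_le_ofReal zero_le_one (by simpa using expNeg_le_one z)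
  have hsum : HasSum (fun n : ℕ => Real.exp (-r) * r ^ n / n.factorial * q ^ n)
      (Real.exp (-(r * (1 - q)))) := by
    have h := (NormedSpace.expSeries_div_hasSum_exp ((r : ℝ) * q)).mul_left (Real.exp (-r))
    rw [← Real.exp_eq_exp_ℝ, ← Real.exp_add] at h
    rw [show -((r : ℝ) * (1 - q)) = -r + r * q by ring]
    refine h.congr_fun fun n => ?_
    rw [mul_pow]; ring
  have hr : (r : ℝ≥0∞) * (1 - expNeg z) = ENNReal.ofReal (r * (1 - q)) := by
    rw [hz, ENNReal.ofReal_mul r.coe_nonneg, ENNReal.ofReal_coe_nnreal,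
      ENNReal.ofReal_sub _ hq0, ENNReal.ofReal_one]
  rw [hr, expNeg_ofReal (mul_nonneg r.coe_nonneg (sub_nonneg.2 hq1)), ← hsum.tsum_eq,
    ENNReal.ofReal_tsum_of_nonneg (fun n => by positivity) hsum.summable, poissonMeasure,
    lintegral_sum_measure]
  refine tsum_congr fun n => ?_
  rw [lintegral_smul_measure, lintegral_dirac, expNeg_mul_natCast, hz, ← ENNReal.ofReal_pow hq0,
    ENNReal.ofReal_mul (by positivity), smul_eq_mul]

lemma tsum_indicator_eq_encard {E : Type*} (x : ℕ → E) (A : Set E) :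
    ∑' n, A.indicator (fun _ => (1 : ℝ≥0∞)) (x n) = ({n | x n ∈ A}.encard : ℝ≥0∞) := by
  rw [← ENNReal.tsum_set_one, tsum_subtype {n | x n ∈ A} (fun _ => (1 : ℝ≥0∞))]
  rfl

namespace IsPoissonProcess

variable {Ω E : Type*} [MeasurableSpace Ω] [MeasurableSpace E] {μ : Measure Ω}
  {X : ℕ → Ω → E} {Λ : Measure E}

/-- Sets of finite intensity almost surely contain finitely many points. -/
lemma ae_encard_ne_top [IsProbabilityMeasure μ] (hX : IsPoissonProcess μ X Λ) {A : Set E}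
    (hA : MeasurableSet A) (hΛ : Λ A ≠ ∞) : ∀ᵐ ω ∂μ, {n | X n ω ∈ A}.encard ≠ ⊤ := by
  have hm : Measurable fun ω => ∑' n, A.indicator (fun _ => (1 : ℝ≥0∞)) (X n ω) :=
    Measurable.tsum fun n => (measurable_const.indicator hA).comp (hX.measurable n)
  have hset : ∀ k : ℕ, {ω | {n | X n ω ∈ A}.encard = (k : ℕ∞)} =
      {ω | ∑' n, A.indicator (fun _ => (1 : ℝ≥0∞)) (X n ω) = k} := fun k => by
    ext ω
    rw [Set.mem_ofPred_eq, Set.mem_ofPred_eq, tsum_indicator_eq_encard, ← ENat.toENNReal_coe,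
      ENat.toENNReal_inj]
  have hmeas : ∀ k : ℕ, MeasurableSet {ω | {n | X n ω ∈ A}.encard = (k : ℕ∞)} := fun k => by
    rw [hset]; exact hm (measurableSet_singleton _)
  have hlaw : ∀ k : ℕ, μ {ω | {n | X n ω ∈ A}.encard = (k : ℕ∞)}
      = poissonMeasure (Λ A).toNNReal {k} := fun k => by
    simpa using hX.law_counts 1 (fun _ => A) (fun _ => k) (fun _ => hA)
      (fun i j hij => absurd (Subsingleton.elim i j) hij) (fun _ => hΛ)
  have hone : μ (⋃ k : ℕ, {ω | {n | X n ω ∈ A}.encard = (k : ℕ∞)}) = 1 := by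
    rw [measure_iUnion _ hmeas]
    · simp_rw [hlaw]
      rw [← measure_iUnion (fun i j hij => by simpa using hij)
        (fun k => measurableSet_singleton k), Set.iUnion_of_singleton, measure_univ]
    · intro i j hij
      refine Set.disjoint_left.2 fun ω hi hj => hij ?_
      exact_mod_cast hi.symm.trans hj
  have hae := (prob_compl_eq_zero_iff (MeasurableSet.iUnion hmeas)).2 hone
  refine measure_mono_null (fun ω hω => ?_) hae
  simp only [Set.mem_compl_iff, Set.mem_ofPred_eq, not_not, ne_eq] at hω
  simp [hω]

/-- The Laplace functional at a combination of indicators of disjoint sets of finite intensity,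
which is the joint generating function of the numbers of points in these sets. -/
lemma lintegral_expNeg_counts [IsProbabilityMeasure μ] (hX : IsPoissonProcess μ X Λ) {m : ℕ}
    {A : Fin m → Set E} (hA : ∀ i, MeasurableSet (A i))
    (hd : Pairwise fun i j => Disjoint (A i) (A j)) (hΛ : ∀ i, Λ (A i) ≠ ∞) (z : Fin m → ℝ≥0∞) :
    ∫⁻ ω, expNeg (∑ i, z i * ∑' n, (A i).indicator (fun _ => (1 : ℝ≥0∞)) (X n ω)) ∂μ
      = expNeg (∑ i, Λ (A i) * (1 - expNeg (z i))) := by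
  have hm : ∀ i, Measurable fun ω => ∑' n, (A i).indicator (fun _ => (1 : ℝ≥0∞)) (X n ω) :=
    fun i => Measurable.tsum fun n =>
      (measurable_const.indicator (hA i)).comp (hX.measurable n)
  let K : Ω → Fin m → ℕ := fun ω i =>
    ⌊(∑' n, (A i).indicator (fun _ => (1 : ℝ≥0∞)) (X n ω)).toReal⌋₊
  have hK : Measurable K := measurable_pi_lambda _ fun i =>
    Nat.measurable_floor.comp (hm i).ennreal_toReal
  have hKe : ∀ᵐ ω ∂μ, ∀ i, {n | X n ω ∈ A i}.encard = (K ω i : ℕ∞) := by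
    rw [ae_all_iff]
    intro i
    filter_upwards [hX.ae_encard_ne_top (hA i) (hΛ i)] with ω hω
    obtain ⟨k, hk⟩ := ENat.ne_top_iff_exists.1 hω
    simp [K, tsum_indicator_eq_encard, ← hk]
  have hlaw : μ.map K = Measure.pi fun i => poissonMeasure (Λ (A i)).toNNReal := by
    refine Measure.ext_of_singleton fun k => ?_
    rw [Measure.map_apply hK (measurableSet_singleton k), Measure.pi_singleton,
      ← hX.law_counts m A k hA hd hΛ]
    refine measure_congr ?_
    filter_upwards [hKe] with ω hω
    refine propext ⟨fun h i => ?_, fun h => funext fun i => ?_⟩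
    · rw [hω i, show K ω = k from h]
    · have h' : {n | X n ω ∈ A i}.encard = (k i : ℕ∞) := h i
      rw [hω i] at h'
      exact_mod_cast h'
  calc ∫⁻ ω, expNeg (∑ i, z i * ∑' n, (A i).indicator (fun _ => (1 : ℝ≥0∞)) (X n ω)) ∂μ
      = ∫⁻ ω, (fun k : Fin m → ℕ => ∏ i, expNeg (z i * (k i : ℕ))) (K ω) ∂μ := by
        refine lintegral_congr_ae ?_
        filter_upwards [hKe] with ω hω
        simp only [expNeg_sum, tsum_indicator_eq_encard, hω, ENat.toENNReal_coe]
    _ = ∫⁻ k, ∏ i, expNeg (z i * (k i : ℕ)) ∂(μ.map K) :=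
        (lintegral_map (f := fun k : Fin m → ℕ => ∏ i, expNeg (z i * (k i : ℕ)))
          (measurable_of_countable _) hK).symm
    _ = ∏ i, ∫⁻ k, expNeg (z i * (k : ℕ)) ∂(poissonMeasure (Λ (A i)).toNNReal) := by
        rw [hlaw]
        have hind := iIndepFun_pi (μ := fun i => poissonMeasure (Λ (A i)).toNNReal)
          (X := fun i (k : ℕ) => expNeg (z i * k))
          (fun i => (measurable_of_countable _).aemeasurable)
        rw [lintegral_prod_eq_prod_lintegral_of_indepFun Finset.univ _ hind
          (fun i => measurable_of_countable _)]
        refine Finset.prod_congr rfl fun i _ => ?_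
        exact (measurePreserving_eval (fun i => poissonMeasure (Λ (A i)).toNNReal) i).lintegral_comp
          (f := fun k : ℕ => expNeg (z i * k)) (measurable_of_countable _)
    _ = _ := by
        simp only [lintegral_expNeg_mul_poissonMeasure, expNeg_sum, ENNReal.coe_toNNReal (hΛ _)]

/-- The Laplace functional of a Poisson process at a simple function supported in a set of finite
intensity. -/
lemma lintegral_expNeg_tsum_simpleFunc [IsProbabilityMeasure μ] (hX : IsPoissonProcess μ X Λ)
    (g : SimpleFunc E ℝ≥0∞) {D : Set E} (hD : MeasurableSet D) (hΛ : Λ D ≠ ∞) :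
    ∫⁻ ω, expNeg (∑' n, D.indicator g (X n ω)) ∂μ
      = expNeg (∫⁻ x, (1 - expNeg (D.indicator g x)) ∂Λ) := by
  classical
  let e := g.range.equivFin
  let A : Fin g.range.card → Set E := fun i => D ∩ g ⁻¹' {(e.symm i : ℝ≥0∞)}
  have hA : ∀ i, MeasurableSet (A i) := fun i => hD.inter (g.measurableSet_fiber _)
  have hd : Pairwise fun i j => Disjoint (A i) (A j) := by
    intro i j hij
    refine Set.disjoint_left.2 fun x hi hj => hij ?_
    exact e.symm.injective (Subtype.ext (hi.2.symm.trans hj.2))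
  have hΛA : ∀ i, Λ (A i) ≠ ∞ := fun i =>
    ne_top_of_le_ne_top hΛ (measure_mono Set.inter_subset_left)
  -- a function of the value of `g` on `D` is a combination of the indicators of the level sets
  have key : ∀ (φ : ℝ≥0∞ → ℝ≥0∞), φ 0 = 0 → ∀ x, φ (D.indicator g x) =
      ∑ i, φ (e.symm i : ℝ≥0∞) * (A i).indicator (fun _ => (1 : ℝ≥0∞)) x := by
    intro φ hφ x
    by_cases hx : x ∈ D
    · rw [Finset.sum_eq_single (e ⟨g x, g.mem_range_self x⟩)]
      · simp [A, hx]
      · intro i _ hi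
        have : x ∉ A i := fun h => hi (by
          rw [← e.symm_apply_eq]; exact Subtype.ext h.2.symm)
        simp [this]
      · simp
    · simp [A, hx, hφ]
  have h1 := hX.lintegral_expNeg_counts hA hd hΛA (fun i => (e.symm i : ℝ≥0∞))
  have h2 : ∫⁻ x, (1 - expNeg (D.indicator g x)) ∂Λ
      = ∑ i, Λ (A i) * (1 - expNeg (e.symm i : ℝ≥0∞)) := by
    simp_rw [key (fun y => 1 - expNeg y) (by simp)]
    rw [lintegral_finsetSum]
    · refine Finset.sum_congr rfl fun i _ => ?_
      rw [lintegral_const_mul _ (measurable_const.indicator (hA i)),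
        lintegral_indicator_const (hA i), one_mul, mul_comm]
    · exact fun i _ => (measurable_const.indicator (hA i)).const_mul _
  rw [h2, ← h1]
  refine lintegral_congr fun ω => ?_
  congr 1
  have hid := key id rfl
  simp only [id] at hid
  simp_rw [hid, ← ENNReal.tsum_mul_left]
  rw [← Summable.tsum_finsetSum (fun _ _ => ENNReal.summable)]

/-- The Laplace functional of a Poisson process. Infinite values of `g` are allowed: the left-hand
side then also asks that there is no point where `g = ∞`. -/
theorem lintegral_expNeg_tsum [IsProbabilityMeasure μ] [SigmaFinite Λ]
    (hX : IsPoissonProcess μ X Λ) {g : E → ℝ≥0∞} (hg : Measurable g) :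
    ∫⁻ ω, expNeg (∑' n, g (X n ω)) ∂μ = expNeg (∫⁻ x, (1 - expNeg (g x)) ∂Λ) := by
  let G : ℕ → E → ℝ≥0∞ := fun k => (spanningSets Λ k).indicator (SimpleFunc.eapprox g k)
  have hGm : ∀ k, Measurable (G k) := fun k =>
    (SimpleFunc.eapprox g k).measurable.indicator (measurableSet_spanningSets Λ k)
  have hmono : ∀ x, Monotone fun k => G k x := by
    intro x i j hij
    refine (Set.indicator_le_indicator_of_subset (monotone_spanningSets Λ hij)
      (fun _ => zero_le) x).trans ?_
    exact Set.indicator_le_indicator (SimpleFunc.monotone_eapprox g hij x)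
  have hsup : ∀ x, ⨆ k, G k x = g x := by
    intro x
    obtain ⟨k, hk⟩ := Set.mem_iUnion.1 ((iUnion_spanningSets Λ).symm ▸ Set.mem_univ x)
    refine le_antisymm (iSup_le fun i => ?_) ?_
    · refine (Set.indicator_le_self' (fun _ _ => zero_le) x).trans ?_
      rw [← SimpleFunc.iSup_eapprox_apply hg x]
      exact le_iSup (fun i => SimpleFunc.eapprox g i x) i
    · rw [← SimpleFunc.iSup_eapprox_apply hg x]
      refine iSup_le fun i => ?_
      refine le_trans ?_ (le_iSup (fun i => G i x) (max i k))
      simp only [G]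
      rw [Set.indicator_of_mem (monotone_spanningSets Λ (le_max_right i k) hk)]
      exact SimpleFunc.monotone_eapprox g (le_max_left i k) x
  have hlim : ∀ x, Tendsto (fun k => G k x) atTop (𝓝 (g x)) := fun x =>
    hsup x ▸ tendsto_atTop_iSup (hmono x)
  have hsum : ∀ ω, Tendsto (fun k => ∑' n, G k (X n ω)) atTop (𝓝 (∑' n, g (X n ω))) := by
    intro ω
    have h := lintegral_tendsto_of_tendsto_of_monotone (μ := (Measure.count : Measure ℕ))
      (f := fun k n => G k (X n ω)) (F := fun n => g (X n ω))
      (fun k => (measurable_of_countable _).aemeasurable)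
      (Eventually.of_forall fun n => hmono (X n ω)) (Eventually.of_forall fun n => hlim (X n ω))
    simpa [lintegral_count] using h
  have hL : Tendsto (fun k => ∫⁻ ω, expNeg (∑' n, G k (X n ω)) ∂μ) atTop
      (𝓝 (∫⁻ ω, expNeg (∑' n, g (X n ω)) ∂μ)) := by
    refine tendsto_lintegral_of_dominated_convergence (fun _ => 1) (fun k => ?_)
      (fun k => Eventually.of_forall fun ω => expNeg_le_one _) (by simp)
      (Eventually.of_forall fun ω => (continuous_expNeg.tendsto _).comp (hsum ω))
    exact measurable_expNeg.comp (Measurable.tsum fun n => (hGm k).comp (hX.measurable n))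
  have hR : Tendsto (fun k => expNeg (∫⁻ x, (1 - expNeg (G k x)) ∂Λ)) atTop
      (𝓝 (expNeg (∫⁻ x, (1 - expNeg (g x)) ∂Λ))) := by
    refine (continuous_expNeg.tendsto _).comp
      (lintegral_tendsto_of_tendsto_of_monotone
        (fun k => (measurable_const.sub (measurable_expNeg.comp (hGm k))).aemeasurable)
        (Eventually.of_forall fun x i j hij =>
          tsub_le_tsub_left (expNeg_antitone (hmono x hij)) 1)
        (Eventually.of_forall fun x => ?_))
    exact ENNReal.Tendsto.sub tendsto_const_nhds ((continuous_expNeg.tendsto _).comp (hlim x))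
      (Or.inl ENNReal.one_ne_top)
  refine tendsto_nhds_unique hL (hR.congr fun k => ?_)
  exact (hX.lintegral_expNeg_tsum_simpleFunc (SimpleFunc.eapprox g k)
    (measurableSet_spanningSets Λ k) (measure_spanningSets_lt_top Λ k).ne).symm

/-- If `g` has finite integral against the intensity, then the sum of `g` over the points is almost
surely finite. -/
lemma ae_tsum_ne_top [IsProbabilityMeasure μ] [SigmaFinite Λ] (hX : IsPoissonProcess μ X Λ)
    {g : E → ℝ≥0∞} (hg : Measurable g) (hfin : ∫⁻ x, g x ∂Λ ≠ ∞) :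
    ∀ᵐ ω ∂μ, ∑' n, g (X n ω) ≠ ∞ := by
  have hm : Measurable fun ω => ∑' n, g (X n ω) :=
    Measurable.tsum fun n => hg.comp (hX.measurable n)
  have hS : MeasurableSet {ω | ∑' n, g (X n ω) ≠ ∞} := (hm (measurableSet_singleton ∞)).compl
  -- the Laplace functional at `g / (k + 1)` vanishes where the sum is infinite, and tends to `1`
  have hle : ∀ k : ℕ, expNeg (((k : ℝ≥0∞) + 1)⁻¹ * ∫⁻ x, g x ∂Λ)
      ≤ μ {ω | ∑' n, g (X n ω) ≠ ∞} := by
    intro k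
    have hk : ((k : ℝ≥0∞) + 1)⁻¹ ≠ 0 := ENNReal.inv_ne_zero.2 (by finiteness)
    rw [← lintegral_const_mul _ hg, ← lintegral_indicator_one hS]
    calc expNeg (∫⁻ x, ((k : ℝ≥0∞) + 1)⁻¹ * g x ∂Λ)
        ≤ expNeg (∫⁻ x, (1 - expNeg (((k : ℝ≥0∞) + 1)⁻¹ * g x)) ∂Λ) :=
          expNeg_antitone (lintegral_mono fun x => one_sub_expNeg_le _)
      _ = ∫⁻ ω, expNeg (∑' n, ((k : ℝ≥0∞) + 1)⁻¹ * g (X n ω)) ∂μ :=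
          (hX.lintegral_expNeg_tsum (hg.const_mul _)).symm
      _ ≤ _ := by
          refine lintegral_mono fun ω => ?_
          by_cases h : ∑' n, g (X n ω) = ∞
          · rw [ENNReal.tsum_mul_left, h, ENNReal.mul_top hk]; simp
          · simp only [Set.indicator, Set.mem_ofPred_eq, ne_eq, h, not_false_eq_true, if_true]
            exact expNeg_le_one _
  have hlim : Tendsto (fun k : ℕ => expNeg (((k : ℝ≥0∞) + 1)⁻¹ * ∫⁻ x, g x ∂Λ)) atTop (𝓝 1) := by
    rw [← expNeg_zero]
    refine (continuous_expNeg.tendsto 0).comp ?_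
    have h0 : Tendsto (fun k : ℕ => ((k : ℝ≥0∞) + 1)⁻¹) atTop (𝓝 0) := by
      have := (tendsto_add_atTop_iff_nat 1).2 ENNReal.tendsto_inv_nat_nhds_zero
      simpa using this
    simpa using ENNReal.Tendsto.mul_const h0 (Or.inr hfin)
  have h1 : (1 : ℝ≥0∞) ≤ μ {ω | ∑' n, g (X n ω) ≠ ∞} :=
    le_of_tendsto hlim (Eventually.of_forall hle)
  exact (prob_compl_eq_zero_iff hS).2 (le_antisymm prob_le_one h1)

/-- The image of a Poisson process under a measurable map. -/
lemma map {F : Type*} [MeasurableSpace F] (hX : IsPoissonProcess μ X Λ) {φ : E → F}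
    (hφ : Measurable φ) : IsPoissonProcess μ (fun n ω => φ (X n ω)) (Λ.map φ) where
  measurable n := hφ.comp (hX.measurable n)
  law_counts m A k hA hd hΛ := by
    have h := hX.law_counts m (fun i => φ ⁻¹' A i) k (fun i => hφ (hA i))
      (fun i j hij => (hd hij).preimage φ)
      (fun i => by rw [← Measure.map_apply hφ (hA i)]; exact hΛ i)
    simpa only [Measure.map_apply hφ (hA _), Set.mem_preimage] using h

end IsPoissonProcess

/-! ### Squared distances form a Poisson process on the half-line -/

/-- The area `π ‖x‖²` of the disc through `x`, scaled by the density, maps a homogeneous Poisson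
process of the plane to a unit-rate process on the half-line. -/
lemma map_area_volume {lam : ℝ} (hlam : 0 < lam) :
    (ENNReal.ofReal lam • (volume : Measure (EuclideanSpace ℝ (Fin 2)))).map
      (fun x => Real.pi * lam * ‖x‖ ^ 2) = volume.restrict (Set.Ioi 0) := by
  have hc : 0 < Real.pi * lam := mul_pos Real.pi_pos hlam
  have hφ : Measurable fun x : EuclideanSpace ℝ (Fin 2) => Real.pi * lam * ‖x‖ ^ 2 := by fun_prop
  have hIic : ∀ b : ℝ, ((ENNReal.ofReal lam • (volume : Measure (EuclideanSpace ℝ (Fin 2)))).map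
      (fun x => Real.pi * lam * ‖x‖ ^ 2)) (Set.Iic b) = ENNReal.ofReal b := by
    intro b
    rw [Measure.map_apply hφ measurableSet_Iic]
    rcases lt_or_ge b 0 with hb | hb
    · rw [ENNReal.ofReal_of_nonpos hb.le]
      convert measure_empty (μ := ENNReal.ofReal lam • volume)
      ext x
      simp only [Set.mem_preimage, Set.mem_Iic, Set.mem_empty_iff_false, iff_false, not_le]
      exact hb.trans_le (by positivity)
    · have : (fun x : EuclideanSpace ℝ (Fin 2) => Real.pi * lam * ‖x‖ ^ 2) ⁻¹' Set.Iic b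
          = Metric.closedBall 0 (Real.sqrt (b / (Real.pi * lam))) := by
        ext x
        rw [Set.mem_preimage, Set.mem_Iic, mem_closedBall_zero_iff,
          Real.le_sqrt (norm_nonneg _) (by positivity), le_div_iff₀ hc, mul_comm]
      rw [this, Measure.smul_apply, EuclideanSpace.volume_closedBall_fin_two,
        ← ENNReal.ofReal_pow (Real.sqrt_nonneg _), Real.sq_sqrt (by positivity),
        ← ENNReal.ofReal_mul (by positivity), smul_eq_mul, ← ENNReal.ofReal_mul hlam.le]
      congr 1
      field_simp
  have hIoc : ∀ a b : ℝ, ((ENNReal.ofReal lam • (volume : Measure (EuclideanSpace ℝ (Fin 2)))).map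
      (fun x => Real.pi * lam * ‖x‖ ^ 2)) (Set.Ioc a b) = ENNReal.ofReal b - ENNReal.ofReal a := by
    intro a b
    rcases le_total a b with hab | hab
    · rw [← Set.Iic_sdiff_Iic, measure_sdiff (Set.Iic_subset_Iic.2 hab)
        measurableSet_Iic.nullMeasurableSet (by rw [hIic]; finiteness), hIic, hIic]
    · rw [Set.Ioc_eq_empty (not_lt.2 hab), measure_empty,
        tsub_eq_zero_of_le (ENNReal.ofReal_le_ofReal hab)]
  refine Measure.ext_of_Ioc' _ _ (fun a b _ => by rw [hIoc]; finiteness) fun a b _ => ?_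
  rw [hIoc, Measure.restrict_apply measurableSet_Ioc, Set.Ioc_inter_Ioi, Real.volume_Ioc,
    ENNReal.ofReal_sub _ (le_max_right a 0)]
  rcases le_total a 0 with ha | ha
  · rw [max_eq_right ha, ENNReal.ofReal_of_nonpos ha, ENNReal.ofReal_zero]
  · rw [max_eq_left ha]

namespace IsPoissonProcess

variable {Ω : Type*} [MeasurableSpace Ω] {μ : Measure Ω} {V : ℕ → Ω → ℝ}

lemma area {lam : ℝ} (hlam : 0 < lam) {X : ℕ → Ω → EuclideanSpace ℝ (Fin 2)}
    (hX : IsPoissonProcess μ X (ENNReal.ofReal lam • volume)) :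
    IsPoissonProcess μ (fun n ω => Real.pi * lam * ‖X n ω‖ ^ 2) (volume.restrict (Set.Ioi 0)) := by
  rw [← map_area_volume hlam]
  exact hX.map (φ := fun x => Real.pi * lam * ‖x‖ ^ 2) (by fun_prop)

variable [IsProbabilityMeasure μ]

lemma ae_pos (hV : IsPoissonProcess μ V (volume.restrict (Set.Ioi 0))) :
    ∀ᵐ ω ∂μ, ∀ n, 0 < V n ω := by
  have h0 : ∫⁻ v in Set.Ioi 0, (Set.Iic (0 : ℝ)).indicator (fun _ => ∞) v = 0 := by
    rw [setLIntegral_congr_fun measurableSet_Ioi (g := fun _ => 0)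
      (fun v (hv : 0 < v) => Set.indicator_of_notMem (s := Set.Iic 0)
        (fun h => not_le.2 hv (Set.mem_Iic.1 h)) _)]
    simp
  filter_upwards [hV.ae_tsum_ne_top (measurable_const.indicator measurableSet_Iic)
    (h0.trans_ne ENNReal.zero_ne_top)] with ω hω n
  by_contra hn
  exact ENNReal.ne_top_of_tsum_ne_top hω n (Set.indicator_of_mem (Set.mem_Iic.2 (not_lt.1 hn)) _)

lemma ae_finite_le (hV : IsPoissonProcess μ V (volume.restrict (Set.Ioi 0))) :
    ∀ᵐ ω ∂μ, ∀ b : ℝ, {n | V n ω ≤ b}.Finite := by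
  have h : ∀ k : ℕ, ∀ᵐ ω ∂μ, {n | V n ω ∈ Set.Iic (k : ℝ)}.encard ≠ ⊤ := fun k => by
    refine hV.ae_encard_ne_top measurableSet_Iic ?_
    rw [Measure.restrict_apply measurableSet_Iic, Set.inter_comm, Set.Ioi_inter_Iic,
      Real.volume_Ioc]
    finiteness
  filter_upwards [ae_all_iff.2 h] with ω hω b
  obtain ⟨k, hk⟩ := exists_nat_ge b
  refine Set.Finite.subset (Set.encard_ne_top_iff.1 (hω k)) fun n hn => ?_
  exact le_trans hn hk

lemma ae_exists_forall_le (hV : IsPoissonProcess μ V (volume.restrict (Set.Ioi 0))) :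
    ∀ᵐ ω ∂μ, ∃ k, ∀ n, V k ω ≤ V n ω := by
  filter_upwards [hV.ae_finite_le] with ω hω
  obtain ⟨k, hk, hmin⟩ := Set.exists_min_image {n | V n ω ≤ V 0 ω} (fun n => V n ω) (hω _)
    ⟨0, le_refl (V 0 ω)⟩
  refine ⟨k, fun n => ?_⟩
  rcases le_total (V n ω) (V 0 ω) with h | h
  · exact hmin n h
  · exact hk.trans h

/-- Away from the origin, the powers `v ^ (-b)` with `b > 1` are almost surely summable over the
points. -/
lemma ae_tsum_rpow_ne_top (hV : IsPoissonProcess μ V (volume.restrict (Set.Ioi 0)))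
    {b : ℝ} (hb : 1 < b) :
    ∀ᵐ ω ∂μ, ∀ ε > 0,
      ∑' n, (if ε < V n ω then ENNReal.ofReal (V n ω ^ (-b)) else 0) ≠ ∞ := by
  have h : ∀ k : ℕ, ∀ᵐ ω ∂μ, ∑' n, (Set.Ioi (((k : ℝ) + 1)⁻¹)).indicator
      (fun v => ENNReal.ofReal (v ^ (-b))) (V n ω) ≠ ∞ := fun k => by
    refine hV.ae_tsum_ne_top (Measurable.indicator (by fun_prop) measurableSet_Ioi) ?_
    have hk : (0 : ℝ) < ((k : ℝ) + 1)⁻¹ := by positivity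
    refine ne_top_of_le_ne_top ?_ (lintegral_mono' Measure.restrict_le_self le_rfl)
    rw [lintegral_indicator measurableSet_Ioi]
    exact (integrableOn_Ioi_rpow_of_lt (neg_lt_neg hb) hk).lintegral_lt_top.ne
  filter_upwards [ae_all_iff.2 h] with ω hω ε hε
  obtain ⟨k, hk⟩ := exists_nat_one_div_lt hε
  refine ne_top_of_le_ne_top (hω k) (ENNReal.tsum_le_tsum fun n => ?_)
  split_ifs with hn
  · rw [Set.indicator_of_mem]
    rw [Set.mem_Ioi, ← one_div]
    exact hk.trans hn
  · exact zero_le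

end IsPoissonProcess

/-! ### Attenuation factors -/

/-- `-log (1 - t)`, so that `expNeg (attenuation t) = 1 - t` for `t < 1`: a product of factors
`1 - t` becomes a sum of attenuations. -/
noncomputable def attenuation (t : ℝ) : ℝ≥0∞ := ENNReal.ofReal (-Real.log (1 - t))

lemma expNeg_attenuation {t : ℝ} (h0 : 0 ≤ t) (h1 : t < 1) :
    expNeg (attenuation t) = ENNReal.ofReal (1 - t) := by
  rw [attenuation, expNeg_ofReal (by
    have := Real.log_nonpos (sub_nonneg.2 h1.le) (by linarith); linarith), neg_neg,
    Real.exp_log (by linarith)]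

lemma attenuation_mono {s t : ℝ} (hst : s ≤ t) (ht : t < 1) : attenuation s ≤ attenuation t :=
  ENNReal.ofReal_le_ofReal (by
    have := Real.log_le_log (sub_pos.2 ht) (sub_le_sub_left hst 1); linarith)

@[fun_prop] lemma measurable_attenuation : Measurable attenuation := by
  unfold attenuation; fun_prop

/-- For `θ = s (u / v) ^ b`, the ratio `θ / (1 + θ)`: the probability that an interferer at area `v`
defeats the signal from area `u`, at threshold `s` and path-loss exponent `2 b`. The form chosen here
gives `0` at `u = 0`. -/
noncomputable def blockProb (s b u v : ℝ) : ℝ := s * u ^ b / (s * u ^ b + v ^ b)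

section blockProb

variable {s b u u' v : ℝ}

lemma blockProb_nonneg (hs : 0 < s) (hu : 0 ≤ u) (hv : 0 < v) : 0 ≤ blockProb s b u v := by
  unfold blockProb; positivity

lemma blockProb_lt_one (hs : 0 < s) (hu : 0 ≤ u) (hv : 0 < v) : blockProb s b u v < 1 := by
  have : 0 < v ^ b := Real.rpow_pos_of_pos hv b
  rw [blockProb, div_lt_one (by positivity)]
  linarith

lemma blockProb_mono (hs : 0 < s) (hb : 0 < b) (hu : 0 ≤ u) (huu : u ≤ u') (hv : 0 < v) :
    blockProb s b u v ≤ blockProb s b u' v := by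
  have hv' : 0 < v ^ b := Real.rpow_pos_of_pos hv b
  have h : u ^ b ≤ u' ^ b := Real.rpow_le_rpow hu huu hb.le
  have h0 : 0 ≤ u ^ b := Real.rpow_nonneg hu b
  unfold blockProb
  rw [div_le_div_iff₀ (by positivity) (by nlinarith)]
  nlinarith [mul_le_mul_of_nonneg_left h hs.le]

/-- An interferer that is farther away than the signal is at most as harmful as one at the same
distance. -/
lemma blockProb_le_div (hs : 0 < s) (hb : 0 < b) (hu : 0 < u) (huv : u ≤ v) :
    blockProb s b u v ≤ s / (1 + s) := by
  have hu' : 0 < u ^ b := Real.rpow_pos_of_pos hu b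
  have h : u ^ b ≤ v ^ b := Real.rpow_le_rpow hu.le huv hb.le
  have hv' : 0 < v ^ b := hu'.trans_le h
  unfold blockProb
  rw [div_le_div_iff₀ (by positivity) (by positivity)]
  nlinarith [mul_le_mul_of_nonneg_left h hs.le]

lemma blockProb_le_rpow (hs : 0 < s) (hu : 0 ≤ u) (hv : 0 < v) :
    blockProb s b u v ≤ s * u ^ b * v ^ (-b) := by
  have hv' : 0 < v ^ b := Real.rpow_pos_of_pos hv b
  have hu' : 0 ≤ u ^ b := Real.rpow_nonneg hu b
  rw [blockProb, Real.rpow_neg hv.le, ← div_eq_mul_inv]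
  exact div_le_div_of_nonneg_left (by positivity) hv' (by nlinarith)

@[fun_prop] lemma measurable_blockProb : Measurable fun p : ℝ × ℝ => blockProb s b p.1 p.2 := by
  unfold blockProb; fun_prop

@[fun_prop] lemma measurable_blockProb_right : Measurable (blockProb s b u) := by
  unfold blockProb; fun_prop

/-- Rescaling both areas leaves the blocking probability unchanged. -/
lemma blockProb_mul (hu : 0 < u) (hv : 0 < v) : blockProb s b u (u * v) = s / (s + v ^ b) := by
  have hu' : 0 < u ^ b := Real.rpow_pos_of_pos hu b
  rw [blockProb, Real.mul_rpow hu.le hv.le]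
  field_simp

lemma integrableOn_blockProb (hs : 0 < s) (hb : 1 < b) (hu : 0 ≤ u) {c : ℝ} (hc : 0 < c) :
    IntegrableOn (blockProb s b u) (Set.Ioi c) := by
  refine Integrable.mono' ((integrableOn_Ioi_rpow_of_lt (neg_lt_neg hb) hc).const_mul (s * u ^ b))
    (measurable_blockProb_right).aestronglyMeasurable ?_
  filter_upwards [ae_restrict_mem measurableSet_Ioi] with v (hv : c < v)
  rw [Real.norm_of_nonneg (blockProb_nonneg hs hu (hc.trans hv))]
  exact blockProb_le_rpow hs hu (hc.trans hv)

end blockProb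

/-- The integral `∫_1^∞ s / (s + v ^ b) dv`. In a unit-rate process on the half-line, a signal from
area `u` is blocked by `u * blockRate s b` farther points on average. -/
noncomputable def blockRate (s b : ℝ) : ℝ := ∫ v in Set.Ioi 1, s / (s + v ^ b)

lemma blockRate_nonneg {s b : ℝ} (hs : 0 < s) : 0 ≤ blockRate s b :=
  setIntegral_nonneg measurableSet_Ioi fun v (hv : 1 < v) => by
    have : 0 < v := one_pos.trans hv
    positivity

lemma lintegral_blockProb_self {s b : ℝ} (hs : 0 < s) (hb : 1 < b) {ρ : ℝ} (hρ : 0 ≤ ρ) {a : ℝ}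
    (ha : 0 ≤ a) :
    ∫⁻ v in Set.Ioi a, ENNReal.ofReal (ρ * blockProb s b a v)
      = ENNReal.ofReal (a * (ρ * blockRate s b)) := by
  rcases ha.eq_or_lt with rfl | ha
  · have : b ≠ 0 := by linarith
    simp [blockProb, Real.zero_rpow this]
  · rw [← ofReal_integral_eq_lintegral_ofReal ((integrableOn_blockProb hs hb ha.le ha).const_mul ρ)]
    · rw [integral_const_mul]
      have h := integral_comp_mul_left_Ioi (blockProb s b a) 1 ha
      rw [mul_one, smul_eq_mul, eq_inv_mul_iff_mul_eq₀ ha.ne'] at h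
      rw [← h, blockRate, setIntegral_congr_fun measurableSet_Ioi
        (fun v (hv : 1 < v) => blockProb_mul ha (one_pos.trans hv))]
      congr 1
      ring
    · filter_upwards [ae_restrict_mem measurableSet_Ioi] with v (hv : a < v)
      exact mul_nonneg hρ (blockProb_nonneg hs ha.le (ha.trans hv))

/-! ### Shells around the origin -/

/-- The weight that forbids points in `(-∞, a]`, gives weight `c` to those in `(a, d]`, and
attenuates by the interferers beyond `d` as seen by a signal from area `u`. -/
noncomputable def shellWeight (s b ρ a d u : ℝ) (c : ℝ≥0∞) (v : ℝ) : ℝ≥0∞ :=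
  if v ≤ a then ∞ else if v ≤ d then c else attenuation (ρ * blockProb s b u v)

@[fun_prop] lemma measurable_shellWeight {s b ρ a d u : ℝ} {c : ℝ≥0∞} :
    Measurable (shellWeight s b ρ a d u c) :=
  Measurable.ite measurableSet_Iic measurable_const
    (Measurable.ite measurableSet_Iic measurable_const (by fun_prop))

lemma IsPoissonProcess.lintegral_shellWeight {Ω : Type*} [MeasurableSpace Ω] {μ : Measure Ω}
    [IsProbabilityMeasure μ] {V : ℕ → Ω → ℝ}
    (hV : IsPoissonProcess μ V (volume.restrict (Set.Ioi 0))) {s b ρ a d u : ℝ} (hs : 0 < s)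
    (hρ : 0 ≤ ρ) (hρ1 : ρ ≤ 1) (ha : 0 ≤ a) (had : a ≤ d) (hu : 0 ≤ u) (c : ℝ≥0∞) :
    ∫⁻ ω, expNeg (∑' n, shellWeight s b ρ a d u c (V n ω)) ∂μ
      = expNeg (ENNReal.ofReal a + ((1 - expNeg c) * ENNReal.ofReal (d - a)
        + ∫⁻ v in Set.Ioi d, ENNReal.ofReal (ρ * blockProb s b u v))) := by
  rw [hV.lintegral_expNeg_tsum measurable_shellWeight, ← Set.Ioc_union_Ioi_eq_Ioi ha,
    lintegral_union measurableSet_Ioi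
      (Set.disjoint_left.2 fun x hx hx' => not_lt.2 hx.2 hx'),
    ← Set.Ioc_union_Ioi_eq_Ioi had, lintegral_union measurableSet_Ioi
      (Set.disjoint_left.2 fun x hx hx' => not_lt.2 hx.2 hx')]
  congr 2
  · rw [setLIntegral_congr_fun measurableSet_Ioc (g := fun _ => 1)]
    · simp
    · intro v hv
      simp [shellWeight, hv.2]
  congr 1
  · rw [setLIntegral_congr_fun measurableSet_Ioc (g := fun _ => 1 - expNeg c)]
    · simp
    · intro v hv
      simp [shellWeight, hv.2, not_le.2 hv.1]
  · refine setLIntegral_congr_fun measurableSet_Ioi fun v (hv : d < v) => ?_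
    have hv0 : 0 < v := (ha.trans had).trans_lt hv
    have h0 := blockProb_nonneg (b := b) hs hu hv0
    have h1 := blockProb_lt_one (b := b) hs hu hv0
    simp only [shellWeight, if_neg (not_le.2 (had.trans_lt hv)), if_neg (not_le.2 hv)]
    rw [expNeg_attenuation (by positivity) (by nlinarith), ← ENNReal.ofReal_one,
      ← ENNReal.ofReal_sub _ (by nlinarith)]
    congr 1
    ring

/-! ### The nearest point of a Poisson process and its interferers -/

/-- The total attenuation of a signal from area `u` by the points `v n` with `u < v n`. -/
noncomputable def totalAttenuation (s b ρ u : ℝ) (v : ℕ → ℝ) : ℝ≥0∞ :=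
  ∑' n, if u < v n then attenuation (ρ * blockProb s b u (v n)) else 0

section shell

variable {s b ρ a d u : ℝ} {v : ℕ → ℝ}

lemma tsum_shellWeight_le (hs : 0 < s) (hb : 0 < b) (hρ : 0 ≤ ρ) (hρ1 : ρ ≤ 1) (ha : 0 ≤ a)
    (hau : a < u) (hud : u ≤ d) (hmin : ∀ n, u ≤ v n) :
    ∑' n, shellWeight s b ρ a d a 0 (v n) ≤ totalAttenuation s b ρ u v := by
  refine ENNReal.tsum_le_tsum fun n => ?_
  unfold shellWeight
  rw [if_neg (not_le.2 (hau.trans_le (hmin n)))]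
  rcases le_or_gt (v n) d with h1 | h1
  · rw [if_pos h1]
    exact zero_le
  · have h2 : u < v n := hud.trans_lt h1
    rw [if_neg (not_le.2 h1), if_pos h2]
    have hv := (ha.trans_lt hau).trans h2
    have := blockProb_lt_one (b := b) hs (ha.trans hau.le) hv
    have := blockProb_nonneg (b := b) hs (ha.trans hau.le) hv
    exact attenuation_mono (mul_le_mul_of_nonneg_left (blockProb_mono hs hb ha hau.le hv) hρ)
      (by nlinarith)

/-- The nearest point itself contributes the constant weight of the shell, which accounts for the
extra term on the left. -/
lemma totalAttenuation_add_le (hs : 0 < s) (hb : 0 < b) (hρ : 0 ≤ ρ) (hρ1 : ρ ≤ 1) (ha : 0 ≤ a)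
    (hau : a < u) (hud : u ≤ d) {k : ℕ} (hk : v k = u) (hmin : ∀ n, u ≤ v n) :
    totalAttenuation s b ρ u v + attenuation (s / (1 + s))
      ≤ ∑' n, shellWeight s b ρ a d d (attenuation (s / (1 + s))) (v n) := by
  have hu : 0 < u := ha.trans_lt hau
  have hs1 : s / (1 + s) < 1 := by rw [div_lt_one (by positivity)]; linarith
  have hC : attenuation (s / (1 + s))
      = ∑' n, if n = k then attenuation (s / (1 + s)) else 0 := 
    (tsum_ite_eq k fun _ => attenuation (s / (1 + s))).symm
  conv_lhs => rw [hC]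
  rw [totalAttenuation, ← ENNReal.tsum_add]
  refine ENNReal.tsum_le_tsum fun n => ?_
  unfold shellWeight
  rw [if_neg (not_le.2 (hau.trans_le (hmin n)))]
  by_cases hn : n = k
  · rw [if_neg (by rw [hn, hk]; exact lt_irrefl u), if_pos hn, zero_add,
      if_pos (by rw [hn, hk]; exact hud)]
  · rw [if_neg hn, add_zero]
    have hv := hu.trans_le (hmin n)
    have h0 := blockProb_nonneg (b := b) hs hu.le hv
    split_ifs with h1 h2 h2
    · refine attenuation_mono ((mul_le_of_le_one_left h0 hρ1).trans ?_) hs1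
      exact blockProb_le_div hs hb hu h1.le
    · have := blockProb_lt_one (b := b) hs (hu.le.trans hud) hv
      have := blockProb_nonneg (b := b) hs (hu.le.trans hud) hv
      exact attenuation_mono (mul_le_mul_of_nonneg_left (blockProb_mono hs hb hu.le hud hv) hρ)
        (by nlinarith)
    · exact zero_le
    · exact zero_le

lemma tsum_shellWeight_eq_top {u' : ℝ} {c : ℝ≥0∞} {k : ℕ} (hk : v k = u) (hua : u ≤ a) :
    ∑' n, shellWeight s b ρ a d u' c (v n) = ∞ :=
  ENNReal.tsum_eq_top_of_eq_top ⟨k, if_pos (hk.trans_le hua)⟩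

lemma tsum_shellWeight_top_eq_top {u' : ℝ} {k : ℕ} (hk : v k = u) (hud : u ≤ d) :
    ∑' n, shellWeight s b ρ a d u' ∞ (v n) = ∞ :=
  ENNReal.tsum_eq_top_of_eq_top ⟨k, by simp [shellWeight, hk, hud]⟩

lemma tsum_shellWeight_congr {u' : ℝ} {c c' : ℝ≥0∞} (hdu : d < u) (hmin : ∀ n, u ≤ v n) :
    ∑' n, shellWeight s b ρ a d u' c (v n) = ∑' n, shellWeight s b ρ a d u' c' (v n) :=
  tsum_congr fun n => by
    simp only [shellWeight, if_neg (not_le.2 (hdu.trans_le (hmin n)))]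

lemma tsum_shellWeight_le_top {u' : ℝ} {c : ℝ≥0∞} :
    ∑' n, shellWeight s b ρ a d u' c (v n) ≤ ∑' n, shellWeight s b ρ a d u' ∞ (v n) :=
  ENNReal.tsum_le_tsum fun n => by
    unfold shellWeight
    split_ifs <;> simp

end shell

lemma exists_nat_mem_shell {u δ : ℝ} (hu : 0 < u) (hδ : 0 < δ) :
    ∃ i : ℕ, i * δ < u ∧ u ≤ i * δ + δ := by
  have h : 0 < ⌈u / δ⌉₊ := Nat.ceil_pos.2 (by positivity)
  refine ⟨⌈u / δ⌉₊ - 1, ?_, ?_⟩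
  · rw [← lt_div_iff₀ hδ]
    exact Nat.lt_ceil.1 (Nat.sub_lt h one_pos)
  · rw [Nat.cast_sub h, Nat.cast_one, sub_mul, one_mul, sub_add_cancel, ← div_le_iff₀ hδ]
    exact Nat.le_ceil _

lemma tsum_ofReal_exp_mul {x c : ℝ} (hx : 0 < x) (hc : 0 ≤ c) :
    ∑' i : ℕ, ENNReal.ofReal (Real.exp (-(i * x)) * c)
      = ENNReal.ofReal (c / (1 - Real.exp (-x))) := by
  have h := (hasSum_geometric_of_lt_one (Real.exp_pos (-x)).le
    (Real.exp_lt_one_iff.2 (neg_lt_zero.2 hx))).mul_right c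
  have he : ∀ i : ℕ, Real.exp (-(i * x)) * c = Real.exp (-x) ^ i * c := fun i => by
    rw [← Real.exp_nat_mul]; ring_nf
  simp_rw [he]
  rw [← ENNReal.ofReal_tsum_of_nonneg (fun i => by positivity) h.summable, h.tsum_eq,
    div_eq_inv_mul]

lemma tendsto_one_sub_exp_div (c : ℝ) :
    Tendsto (fun x => (1 - Real.exp (-(x * c))) / x) (𝓝[>] 0) (𝓝 c) := by
  have h : HasDerivAt (fun x => -Real.exp (-(x * c))) c 0 := by
    have := (((hasDerivAt_id (0 : ℝ)).mul_const c).fun_neg.exp).fun_neg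
    simpa using this
  have h2 := h.tendsto_slope.mono_left (nhdsGT_le_nhdsNE 0)
  refine h2.congr fun x => ?_
  simp [slope_def_field, sub_eq_neg_add, add_comm]

namespace IsPoissonProcess

variable {Ω : Type*} [MeasurableSpace Ω] {μ : Measure Ω} [IsProbabilityMeasure μ]
  {V : ℕ → Ω → ℝ} {U : Ω → ℝ} {s b ρ : ℝ}

lemma lintegral_shellWeight_sub (hV : IsPoissonProcess μ V (volume.restrict (Set.Ioi 0)))
    {a d u : ℝ} {c : ℝ≥0∞} :
    ∫⁻ ω, (expNeg (∑' n, shellWeight s b ρ a d u c (V n ω))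
        - expNeg (∑' n, shellWeight s b ρ a d u ∞ (V n ω))) ∂μ
      = ∫⁻ ω, expNeg (∑' n, shellWeight s b ρ a d u c (V n ω)) ∂μ
        - ∫⁻ ω, expNeg (∑' n, shellWeight s b ρ a d u ∞ (V n ω)) ∂μ := by
  refine lintegral_sub ?_ ?_ (Eventually.of_forall fun ω =>
    expNeg_antitone tsum_shellWeight_le_top)
  · exact measurable_expNeg.comp (Measurable.tsum fun n =>
      measurable_shellWeight.comp (hV.measurable n))
  · refine ne_top_of_le_ne_top ENNReal.one_ne_top ?_
    simpa using lintegral_mono (μ := μ) fun ω =>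
      expNeg_le_one (∑' n, shellWeight s b ρ a d u ∞ (V n ω))

/-- Upper bound by a decomposition into shells of width `δ`: in the shell of the nearest point, the
signal is at least as strong as from the inner boundary, and only interferers beyond the outer
boundary are counted. -/
lemma lintegral_totalAttenuation_mul_le (hV : IsPoissonProcess μ V (volume.restrict (Set.Ioi 0)))
    (hU : ∀ᵐ ω ∂μ, 0 < U ω ∧ (∃ k, V k ω = U ω) ∧ ∀ n, U ω ≤ V n ω)
    (hs : 0 < s) (hb : 1 < b) (hρ : 0 ≤ ρ) (hρ1 : ρ ≤ 1) {δ : ℝ} (hδ : 0 < δ) :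
    (∫⁻ ω, expNeg (totalAttenuation s b ρ (U ω) fun n => V n ω) ∂μ) * ENNReal.ofReal (Real.exp (-δ))
      ≤ ENNReal.ofReal ((1 - Real.exp (-δ))
        / (1 - Real.exp (-(δ * (1 + ρ * blockRate s b))))) := by
  have hκ : 0 ≤ ρ * blockRate s b := mul_nonneg hρ (blockRate_nonneg hs)
  have hm : ∀ i : ℕ, Measurable fun ω =>
      expNeg (∑' n, shellWeight s b ρ (i * δ) (i * δ + δ) (i * δ) 0 (V n ω))
        - expNeg (∑' n, shellWeight s b ρ (i * δ) (i * δ + δ) (i * δ) ∞ (V n ω)) := fun i =>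
    (measurable_expNeg.comp (Measurable.tsum fun n =>
      measurable_shellWeight.comp (hV.measurable n))).sub
    (measurable_expNeg.comp (Measurable.tsum fun n =>
      measurable_shellWeight.comp (hV.measurable n)))
  have hle : ∫⁻ ω, expNeg (totalAttenuation s b ρ (U ω) fun n => V n ω) ∂μ
      ≤ ∑' i : ℕ, ∫⁻ ω, (expNeg (∑' n, shellWeight s b ρ (i * δ) (i * δ + δ) (i * δ) 0 (V n ω))
        - expNeg (∑' n, shellWeight s b ρ (i * δ) (i * δ + δ) (i * δ) ∞ (V n ω))) ∂μ := by
    rw [← lintegral_tsum fun i => (hm i).aemeasurable]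
    refine lintegral_mono_ae ?_
    filter_upwards [hU] with ω ⟨h0, ⟨k, hk⟩, hmin⟩
    obtain ⟨i, hi1, hi2⟩ := exists_nat_mem_shell h0 hδ
    refine le_trans ?_ (ENNReal.le_tsum i)
    rw [tsum_shellWeight_top_eq_top hk hi2, expNeg_top, tsub_zero]
    exact expNeg_antitone
      (tsum_shellWeight_le hs (by linarith) hρ hρ1 (by positivity) hi1 hi2 hmin)
  have hterm : ∀ i : ℕ,
      (∫⁻ ω, (expNeg (∑' n, shellWeight s b ρ (i * δ) (i * δ + δ) (i * δ) 0 (V n ω))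
        - expNeg (∑' n, shellWeight s b ρ (i * δ) (i * δ + δ) (i * δ) ∞ (V n ω))) ∂μ)
        * ENNReal.ofReal (Real.exp (-δ))
      ≤ ENNReal.ofReal (Real.exp (-(i * (δ * (1 + ρ * blockRate s b)))) * (1 - Real.exp (-δ))) := by
    intro i
    obtain ⟨a, ha⟩ : ∃ a : ℝ, a = i * δ := ⟨_, rfl⟩
    have ha0 : 0 ≤ a := by rw [ha]; positivity
    have had : a ≤ a + δ := by linarith
    rw [← ha, hV.lintegral_shellWeight_sub, hV.lintegral_shellWeight hs hρ hρ1 ha0 had ha0,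
      hV.lintegral_shellWeight hs hρ hρ1 ha0 had ha0]
    obtain ⟨I, hI⟩ : ∃ I, I = ∫⁻ v in Set.Ioi (a + δ), ENNReal.ofReal (ρ * blockProb s b a v) :=
      ⟨_, rfl⟩
    rw [← hI, expNeg_zero, expNeg_top, tsub_self, zero_mul, zero_add, tsub_zero, one_mul,
      add_sub_cancel_left, show ENNReal.ofReal a + (ENNReal.ofReal δ + I)
        = (ENNReal.ofReal a + I) + ENNReal.ofReal δ by ring, expNeg_add _ (ENNReal.ofReal δ),
      expNeg_ofReal hδ.le]
    have hself : ENNReal.ofReal (a * (1 + ρ * blockRate s b))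
        ≤ ENNReal.ofReal a + I + ENNReal.ofReal δ := by
      rw [mul_add, mul_one, ENNReal.ofReal_add ha0 (by positivity), add_assoc,
        ← lintegral_blockProb_self hs hb hρ ha0, ← Set.Ioc_union_Ioi_eq_Ioi had,
        lintegral_union measurableSet_Ioi
          (Set.disjoint_left.2 fun x hx hx' => not_lt.2 hx.2 hx'), ← hI, add_comm I]
      gcongr
      calc ∫⁻ v in Set.Ioc a (a + δ), ENNReal.ofReal (ρ * blockProb s b a v)
          ≤ ∫⁻ v in Set.Ioc a (a + δ), 1 := by
            refine setLIntegral_mono measurable_const fun v hv => ?_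
            have hv0 : 0 < v := ha0.trans_lt hv.1
            have := blockProb_lt_one (b := b) hs ha0 hv0
            have := blockProb_nonneg (b := b) hs ha0 hv0
            rw [← ENNReal.ofReal_one]
            exact ENNReal.ofReal_le_ofReal (by nlinarith)
        _ = ENNReal.ofReal δ := by simp
    have hx : expNeg (ENNReal.ofReal a + I) * ENNReal.ofReal (Real.exp (-δ))
        ≤ ENNReal.ofReal (Real.exp (-(a * (1 + ρ * blockRate s b)))) := by
      rw [← expNeg_ofReal hδ.le, ← expNeg_add, ← expNeg_ofReal (by positivity)]
      exact expNeg_antitone hself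
    have hsub : expNeg (ENNReal.ofReal a + I)
        - expNeg (ENNReal.ofReal a + I) * ENNReal.ofReal (Real.exp (-δ))
        = expNeg (ENNReal.ofReal a + I) * ENNReal.ofReal (1 - Real.exp (-δ)) := by
      rw [ENNReal.ofReal_sub _ (Real.exp_pos _).le, ENNReal.ofReal_one,
        ENNReal.mul_sub (fun _ _ => expNeg_ne_top _), mul_one]
    rw [hsub, mul_right_comm, ← mul_assoc, ← ha, ENNReal.ofReal_mul (Real.exp_pos _).le]
    gcongr
  calc _ ≤ (∑' i : ℕ, ∫⁻ ω,
        (expNeg (∑' n, shellWeight s b ρ (i * δ) (i * δ + δ) (i * δ) 0 (V n ω))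
        - expNeg (∑' n, shellWeight s b ρ (i * δ) (i * δ + δ) (i * δ) ∞ (V n ω))) ∂μ)
        * ENNReal.ofReal (Real.exp (-δ)) := by gcongr
    _ ≤ ∑' i : ℕ, ENNReal.ofReal
        (Real.exp (-(i * (δ * (1 + ρ * blockRate s b)))) * (1 - Real.exp (-δ))) := by
      rw [← ENNReal.tsum_mul_right]
      exact ENNReal.tsum_le_tsum hterm
    _ = _ := tsum_ofReal_exp_mul (by positivity)
      (sub_nonneg.2 (Real.exp_le_one_iff.2 (by linarith)))

/-- Lower bound by a decomposition into shells of width `δ`: in the shell of the nearest point, the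
signal is at least as strong as from the outer boundary, and every further point of the shell is
counted as an interferer at the distance of the signal. -/
lemma le_lintegral_totalAttenuation (hV : IsPoissonProcess μ V (volume.restrict (Set.Ioi 0)))
    (hU : ∀ᵐ ω ∂μ, 0 < U ω ∧ (∃ k, V k ω = U ω) ∧ ∀ n, U ω ≤ V n ω)
    (hs : 0 < s) (hb : 1 < b) (hρ : 0 ≤ ρ) (hρ1 : ρ ≤ 1) {δ : ℝ} (hδ : 0 < δ) :
    ENNReal.ofReal (Real.exp (-(δ * (ρ * blockRate s b)))
        * (Real.exp (-(δ * (s / (1 + s)))) - Real.exp (-δ))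
        / (1 - Real.exp (-(δ * (1 + ρ * blockRate s b)))))
      ≤ ENNReal.ofReal (1 - s / (1 + s))
        * ∫⁻ ω, expNeg (totalAttenuation s b ρ (U ω) fun n => V n ω) ∂μ := by
  have hκ : 0 ≤ ρ * blockRate s b := mul_nonneg hρ (blockRate_nonneg hs)
  have hs0 : 0 ≤ s / (1 + s) := by positivity
  have hs1 : s / (1 + s) < 1 := by rw [div_lt_one (by positivity)]; linarith
  obtain ⟨C, hC⟩ : ∃ C, C = attenuation (s / (1 + s)) := ⟨_, rfl⟩
  have hCe : expNeg C = ENNReal.ofReal (1 - s / (1 + s)) := by rw [hC, expNeg_attenuation hs0 hs1]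
  have hm : ∀ i : ℕ, Measurable fun ω =>
      expNeg (∑' n, shellWeight s b ρ (i * δ) (i * δ + δ) (i * δ + δ) C (V n ω))
        - expNeg (∑' n, shellWeight s b ρ (i * δ) (i * δ + δ) (i * δ + δ) ∞ (V n ω)) := fun i =>
    (measurable_expNeg.comp (Measurable.tsum fun n =>
      measurable_shellWeight.comp (hV.measurable n))).sub
    (measurable_expNeg.comp (Measurable.tsum fun n =>
      measurable_shellWeight.comp (hV.measurable n)))
  have hle : ∑' i : ℕ, ∫⁻ ω,
        (expNeg (∑' n, shellWeight s b ρ (i * δ) (i * δ + δ) (i * δ + δ) C (V n ω))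
        - expNeg (∑' n, shellWeight s b ρ (i * δ) (i * δ + δ) (i * δ + δ) ∞ (V n ω))) ∂μ
      ≤ ENNReal.ofReal (1 - s / (1 + s))
        * ∫⁻ ω, expNeg (totalAttenuation s b ρ (U ω) fun n => V n ω) ∂μ := by
    rw [← lintegral_tsum fun i => (hm i).aemeasurable,
      ← lintegral_const_mul' _ _ ENNReal.ofReal_ne_top]
    refine lintegral_mono_ae ?_
    filter_upwards [hU] with ω ⟨h0, ⟨k, hk⟩, hmin⟩
    obtain ⟨i, hi1, hi2⟩ := exists_nat_mem_shell h0 hδ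
    -- only the shell of the nearest point contributes
    rw [tsum_eq_single i]
    · refine tsub_le_self.trans ?_
      rw [← hCe, ← expNeg_add, add_comm C, hC]
      exact expNeg_antitone
        (totalAttenuation_add_le hs (by linarith) hρ hρ1 (by positivity) hi1 hi2 hk hmin)
    · intro j hj
      rcases lt_or_gt_of_ne hj with hji | hij
      · have : (j : ℝ) + 1 ≤ i := by exact_mod_cast hji
        rw [tsum_shellWeight_congr (c := C) (c' := ∞)
          (lt_of_le_of_lt (by nlinarith : (j : ℝ) * δ + δ ≤ i * δ) hi1) hmin, tsub_self]
      · have : (i : ℝ) + 1 ≤ j := by exact_mod_cast hij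
        rw [tsum_shellWeight_eq_top (c := C) hk
          (hi2.trans (by nlinarith : (i : ℝ) * δ + δ ≤ j * δ)), expNeg_top, zero_tsub]
  refine le_trans (le_of_eq ?_) hle
  rw [← tsum_ofReal_exp_mul (by positivity) (mul_nonneg (Real.exp_pos _).le
    (sub_nonneg.2 (Real.exp_le_exp.2 (neg_le_neg (by nlinarith)))))]
  refine tsum_congr fun i => ?_
  obtain ⟨a, ha⟩ : ∃ a : ℝ, a = i * δ := ⟨_, rfl⟩
  have ha0 : 0 ≤ a := by rw [ha]; positivity
  have had : a ≤ a + δ := by linarith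
  have hd0 : 0 ≤ a + δ := by linarith
  rw [← ha, hV.lintegral_shellWeight_sub, hV.lintegral_shellWeight hs hρ hρ1 ha0 had hd0,
    hV.lintegral_shellWeight hs hρ hρ1 ha0 had hd0, lintegral_blockProb_self hs hb hρ hd0,
    hCe, expNeg_top, tsub_zero, one_mul, ← ENNReal.ofReal_one,
    ← ENNReal.ofReal_sub _ (by linarith), add_sub_cancel_left, sub_sub_cancel,
    ← ENNReal.ofReal_mul hs0, ← ENNReal.ofReal_add (by positivity) (by positivity),
    ← ENNReal.ofReal_add (by positivity) (by positivity),
    ← ENNReal.ofReal_add (by positivity) (by positivity),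
    ← ENNReal.ofReal_add (by positivity) (by positivity), expNeg_ofReal (by positivity),
    expNeg_ofReal (by positivity), ← ENNReal.ofReal_sub _ (Real.exp_pos _).le]
  congr 1
  rw [mul_sub, mul_sub, ← Real.exp_add, ← Real.exp_add, ← Real.exp_add, ← Real.exp_add]
  congr 2 <;> rw [ha] <;> ring

/-- If every station interferes with probability `ρ`, the signal from the nearest point survives
with probability `1 / (1 + ρ κ)`, where `κ` is `blockRate`. -/
theorem lintegral_totalAttenuation (hV : IsPoissonProcess μ V (volume.restrict (Set.Ioi 0)))
    (hU : ∀ᵐ ω ∂μ, 0 < U ω ∧ (∃ k, V k ω = U ω) ∧ ∀ n, U ω ≤ V n ω)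
    (hs : 0 < s) (hb : 1 < b) (hρ : 0 ≤ ρ) (hρ1 : ρ ≤ 1) :
    ∫⁻ ω, expNeg (totalAttenuation s b ρ (U ω) fun n => V n ω) ∂μ
      = ENNReal.ofReal (1 / (1 + ρ * blockRate s b)) := by
  have hκ : 0 ≤ ρ * blockRate s b := mul_nonneg hρ (blockRate_nonneg hs)
  obtain ⟨m, hmdef⟩ : ∃ m, m = 1 + ρ * blockRate s b := ⟨_, rfl⟩
  have hm : 0 < m := by linarith
  have hz : 0 < 1 - s / (1 + s) := by
    rw [sub_pos, div_lt_one (by positivity)]; linarith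
  obtain ⟨I, hI⟩ : ∃ I, I = ∫⁻ ω, expNeg (totalAttenuation s b ρ (U ω) fun n => V n ω) ∂μ :=
    ⟨_, rfl⟩
  have hItop : I ≠ ∞ := by
    refine ne_top_of_le_ne_top ENNReal.one_ne_top ?_
    rw [hI]
    simpa using lintegral_mono (μ := μ) fun ω =>
      expNeg_le_one (totalAttenuation s b ρ (U ω) fun n => V n ω)
  have hpos : ∀ δ : ℝ, 0 < δ → 0 < 1 - Real.exp (-(δ * m)) := fun δ hδ =>
    sub_pos.2 (Real.exp_lt_one_iff.2 (neg_lt_zero.2 (by positivity)))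
  have hup : ∀ δ > 0, I.toReal * Real.exp (-δ)
      ≤ ((1 - Real.exp (-(δ * 1))) / δ) / ((1 - Real.exp (-(δ * m))) / δ) := by
    intro δ hδ
    have h := hV.lintegral_totalAttenuation_mul_le hU hs hb hρ hρ1 hδ
    rw [← hI, ← ENNReal.ofReal_toReal hItop, ← ENNReal.ofReal_mul ENNReal.toReal_nonneg,
      ← hmdef] at h
    rw [div_div_div_cancel_right₀ hδ.ne', mul_one]
    exact (ENNReal.ofReal_le_ofReal_iff (div_nonneg
      (sub_nonneg.2 (Real.exp_le_one_iff.2 (by linarith))) (hpos δ hδ).le)).1 h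
  have hlow : ∀ δ > 0, Real.exp (-(δ * (ρ * blockRate s b)))
      * ((1 - Real.exp (-(δ * 1))) / δ - (1 - Real.exp (-(δ * (s / (1 + s))))) / δ)
        / ((1 - Real.exp (-(δ * m))) / δ) ≤ (1 - s / (1 + s)) * I.toReal := by
    intro δ hδ
    have h := hV.le_lintegral_totalAttenuation hU hs hb hρ hρ1 hδ
    rw [← hI, ← ENNReal.ofReal_toReal hItop, ← ENNReal.ofReal_mul hz.le, ← hmdef] at h
    have h' := (ENNReal.ofReal_le_ofReal_iff (by positivity)).1 h
    rw [← sub_div, ← mul_div_assoc, div_div_div_cancel_right₀ hδ.ne', sub_sub_sub_cancel_left,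
      mul_one]
    exact h'
  have hmem : ∀ᶠ δ : ℝ in 𝓝[>] 0, 0 < δ := eventually_mem_nhdsWithin
  have hexp : ∀ c : ℝ, Tendsto (fun δ : ℝ => Real.exp (-(δ * c))) (𝓝[>] 0) (𝓝 1) := fun c => by
    have : Continuous fun δ : ℝ => Real.exp (-(δ * c)) := by fun_prop
    simpa using (this.tendsto 0).mono_left nhdsWithin_le_nhds
  have h1 : I.toReal ≤ 1 / m := by
    have hl : Tendsto (fun δ : ℝ => I.toReal * Real.exp (-δ)) (𝓝[>] 0) (𝓝 (I.toReal * 1)) := by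
      simpa using (hexp 1).const_mul I.toReal
    have := le_of_tendsto_of_tendsto hl
      ((tendsto_one_sub_exp_div 1).div (tendsto_one_sub_exp_div m) hm.ne')
      (hmem.mono fun δ hδ => hup δ hδ)
    simpa using this
  have h2 : 1 / m ≤ I.toReal := by
    have hl := ((hexp (ρ * blockRate s b)).mul ((tendsto_one_sub_exp_div 1).sub
      (tendsto_one_sub_exp_div (s / (1 + s))))).div (tendsto_one_sub_exp_div m) hm.ne'
    have := le_of_tendsto hl (hmem.mono fun δ hδ => hlow δ hδ)
    rw [one_mul, div_eq_mul_one_div] at this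
    exact le_of_mul_le_mul_left this hz
  rw [← hI, ← hmdef, ← ENNReal.ofReal_toReal hItop, le_antisymm h1 h2]

end IsPoissonProcess

/-! ### Rayleigh fading -/

lemma lintegral_Ioi_mul_exp_neg_mul_sq {c y : ℝ} (hc : 0 < c) (hy : 0 ≤ y) :
    ∫⁻ a in Set.Ioi y, ENNReal.ofReal (2 * a * Real.exp (-(c * a ^ 2)))
      = ENNReal.ofReal (Real.exp (-(c * y ^ 2)) / c) := by
  have hderiv : ∀ x : ℝ, HasDerivAt (fun a => -(Real.exp (-(c * a ^ 2)) / c))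
      (2 * x * Real.exp (-(c * x ^ 2))) x := by
    intro x
    have h := ((((hasDerivAt_pow 2 x).const_mul c).fun_neg.exp).div_const c).fun_neg
    refine h.congr_deriv ?_
    norm_num
    field_simp
  have hlim : Tendsto (fun a : ℝ => -(Real.exp (-(c * a ^ 2)) / c)) atTop (𝓝 0) := by
    have h1 : Tendsto (fun a : ℝ => c * a ^ 2) atTop atTop :=
      (tendsto_pow_atTop two_ne_zero).const_mul_atTop hc
    simpa using ((Real.tendsto_exp_neg_atTop_nhds_zero.comp h1).div_const c).neg
  have hnn : ∀ x ∈ Set.Ioi y, 0 ≤ 2 * x * Real.exp (-(c * x ^ 2)) := fun x (hx : y < x) => by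
    have := hy.trans_lt hx
    positivity
  rw [← ofReal_integral_eq_lintegral_ofReal
    (integrableOn_Ioi_deriv_of_nonneg' (fun x _ => hderiv x) hnn hlim)
    ((ae_restrict_mem measurableSet_Ioi).mono hnn),
    integral_Ioi_of_hasDerivAt_of_nonneg' (fun x _ => hderiv x) hnn hlim]
  simp

/-- The squared fading modulus is exponentially distributed. -/
lemma rayleighUnit_le_sq (y : ℝ≥0∞) :
    rayleighUnit {a | y ≤ ENNReal.ofReal (a ^ 2)} = expNeg y := by
  by_cases hy : y = ∞
  · simp [hy]
  lift y to NNReal using hy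
  have hset : ({a : ℝ | (y : ℝ≥0∞) ≤ ENNReal.ofReal (a ^ 2)} ∩ Set.Ioi 0 : Set ℝ)
      =ᵐ[volume] Set.Ioi (Real.sqrt y) := by
    have : {a : ℝ | (y : ℝ≥0∞) ≤ ENNReal.ofReal (a ^ 2)} ∩ Set.Ioi 0
        = Set.Ici (Real.sqrt y) ∩ Set.Ioi 0 := by
      ext a
      simp only [Set.mem_inter_iff, Set.mem_ofPred_eq, Set.mem_Ioi, Set.mem_Ici,
        and_congr_left_iff]
      intro ha
      rw [Real.sqrt_le_left ha.le, ← ENNReal.ofReal_coe_nnreal,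
        ENNReal.ofReal_le_ofReal_iff (by positivity)]
    rw [this]
    refine (ae_eq_set_inter Ioi_ae_eq_Ici.symm (ae_eq_refl _)).trans ?_
    rw [Set.inter_eq_left.2 (Set.Ioi_subset_Ioi (Real.sqrt_nonneg _))]
    exact ae_eq_refl _
  have hm : MeasurableSet {a : ℝ | (y : ℝ≥0∞) ≤ ENNReal.ofReal (a ^ 2)} :=
    measurableSet_le measurable_const (by fun_prop)
  have h := lintegral_Ioi_mul_exp_neg_mul_sq one_pos (Real.sqrt_nonneg y)
  rw [Real.sq_sqrt y.coe_nonneg] at h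
  rw [rayleighUnit, withDensity_apply _ hm, Measure.restrict_restrict hm,
    Measure.restrict_congr_set hset, ← ENNReal.ofReal_coe_nnreal, expNeg_ofReal y.coe_nonneg]
  simpa using h

lemma lintegral_expNeg_mul_sq_rayleighUnit {θ : ℝ} (hθ : 0 ≤ θ) :
    ∫⁻ a, expNeg (ENNReal.ofReal (θ * a ^ 2)) ∂rayleighUnit = ENNReal.ofReal (1 / (1 + θ)) := by
  have h := lintegral_Ioi_mul_exp_neg_mul_sq (c := 1 + θ) (by linarith) le_rfl
  rw [rayleighUnit, lintegral_withDensity_eq_lintegral_mul _ (by fun_prop) (by fun_prop)]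
  calc _ = ∫⁻ a in Set.Ioi 0, ENNReal.ofReal (2 * a * Real.exp (-((1 + θ) * a ^ 2))) := by
        refine lintegral_congr fun a => ?_
        rw [Pi.mul_apply, expNeg_ofReal (by positivity), ← ENNReal.ofReal_mul' (Real.exp_pos _).le,
          mul_assoc, ← Real.exp_add]
        congr 4
        ring
    _ = _ := by simpa using h

/-! ### Independent marks -/

section marks

variable {Ω γ : Type*} [MeasurableSpace Ω] [MeasurableSpace γ] {μ : Measure Ω}

/-- In an independent sequence, a term is independent of a series in the other terms. -/
lemma indepFun_tsum {Z : ℕ → Ω → γ} (hZ : iIndepFun Z μ) (hZm : ∀ n, Measurable (Z n))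
    {φ : ℕ → γ → ℝ≥0∞} (hφ : ∀ n, Measurable (φ n)) {k : ℕ} (hk : ∀ z, φ k z = 0) :
    IndepFun (Z k) (fun ω => ∑' n, φ n (Z n ω)) μ := by
  have h := indep_iSup_of_disjoint (fun n => (hZm n).comap_le) hZ
    (S := {k}) (T := {k}ᶜ) disjoint_compl_right
  rw [IndepFun_iff_Indep]
  refine indep_of_indep_of_le_left (indep_of_indep_of_le_right h ?_) ?_
  · refine Measurable.comap_le ?_
    let _ : MeasurableSpace Ω := ⨆ n ∈ ({k}ᶜ : Set ℕ), MeasurableSpace.comap (Z n) inferInstance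
    refine Measurable.tsum fun n => ?_
    by_cases hn : n = k
    · subst hn
      simp only [hk]
      exact measurable_const
    · exact (hφ n).comp ((comap_measurable (Z n)).mono
        (le_iSup₂ (f := fun i (_ : i ∈ ({k}ᶜ : Set ℕ)) => MeasurableSpace.comap (Z i) _) n hn)
        le_rfl)
  · exact le_iSup₂ (f := fun i (_ : i ∈ ({k} : Set ℕ)) => MeasurableSpace.comap (Z i) _) k rfl

lemma lintegral_expNeg_tsum_of_iIndepFun [IsProbabilityMeasure μ] {Y : ℕ → Ω → ℝ≥0∞}
    (hY : iIndepFun Y μ) (hYm : ∀ n, Measurable (Y n)) {a : ℕ → ℝ≥0∞}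
    (ha : ∀ n, ∫⁻ ω, expNeg (Y n ω) ∂μ = expNeg (a n)) :
    ∫⁻ ω, expNeg (∑' n, Y n ω) ∂μ = expNeg (∑' n, a n) := by
  have hL : Tendsto (fun m => ∫⁻ ω, expNeg (∑ n ∈ Finset.range m, Y n ω) ∂μ) atTop
      (𝓝 (∫⁻ ω, expNeg (∑' n, Y n ω) ∂μ)) :=
    tendsto_lintegral_of_dominated_convergence (fun _ => 1) (fun m => by fun_prop)
      (fun m => Eventually.of_forall fun ω => expNeg_le_one _) (by simp)
      (Eventually.of_forall fun ω =>
        (continuous_expNeg.tendsto _).comp (ENNReal.tendsto_nat_tsum _))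
  have hR : Tendsto (fun m => expNeg (∑ n ∈ Finset.range m, a n)) atTop
      (𝓝 (expNeg (∑' n, a n))) :=
    (continuous_expNeg.tendsto _).comp (ENNReal.tendsto_nat_tsum _)
  refine tendsto_nhds_unique hL (hR.congr fun m => ?_)
  simp_rw [expNeg_sum, ← ha]
  exact (lintegral_prod_eq_prod_lintegral_of_indepFun _ (fun n ω => expNeg (Y n ω))
    (hY.comp (fun _ => expNeg) fun _ => measurable_expNeg)
    (fun n => measurable_expNeg.comp (hYm n))).symm

/-- A unit exponential variable exceeds an independent variable `Y` with probability `E e^{-Y}`. -/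
lemma measure_le_sq_of_indepFun [IsProbabilityMeasure μ] {h : Ω → ℝ} {Y : Ω → ℝ≥0∞}
    (hm : Measurable h) (hY : Measurable Y) (hlaw : μ.map h = rayleighUnit) (hind : IndepFun h Y μ) :
    μ {ω | Y ω ≤ ENNReal.ofReal (h ω ^ 2)} = ∫⁻ ω, expNeg (Y ω) ∂μ := by
  have hS : MeasurableSet {q : ℝ≥0∞ × ℝ | q.1 ≤ ENNReal.ofReal (q.2 ^ 2)} :=
    measurableSet_le measurable_fst (by fun_prop)
  have hprob : IsProbabilityMeasure (μ.map h) := Measure.isProbabilityMeasure_map hm.aemeasurable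
  calc μ {ω | Y ω ≤ ENNReal.ofReal (h ω ^ 2)}
      = (μ.map fun ω => (Y ω, h ω)) {q : ℝ≥0∞ × ℝ | q.1 ≤ ENNReal.ofReal (q.2 ^ 2)} := by
        rw [Measure.map_apply (hY.prodMk hm) hS]; rfl
    _ = ∫⁻ y, expNeg y ∂(μ.map Y) := by
        rw [hind.symm.map_prod_eq_prod_map_map hY.aemeasurable hm.aemeasurable,
          Measure.prod_apply hS, hlaw]
        exact lintegral_congr fun y => rayleighUnit_le_sq y
    _ = _ := lintegral_map measurable_expNeg hY

/-- The Laplace transform of the power of an interferer that transmits with Rayleigh fading if its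
packet is in `D`, and is silent otherwise. -/
lemma lintegral_expNeg_ite_rayleigh [IsProbabilityMeasure μ] {h : Ω → ℝ} {j : Ω → γ}
    [MeasurableSingletonClass γ] (hm : Measurable h) (hj : Measurable j)
    (hlaw : μ.map h = rayleighUnit) (hind : IndepFun h j μ) {D : Set γ} (hD : MeasurableSet D)
    [DecidablePred (· ∈ D)] {θ : ℝ} (hθ : 0 ≤ θ) :
    ∫⁻ ω, expNeg (if j ω ∈ D then ENNReal.ofReal (θ * h ω ^ 2) else 0) ∂μ
      = ENNReal.ofReal (1 - μ.real (j ⁻¹' D) * (θ / (1 + θ))) := by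
  have h1 : ∫⁻ ω, expNeg (ENNReal.ofReal (θ * h ω ^ 2)) * D.indicator 1 (j ω) ∂μ
      = ENNReal.ofReal (1 / (1 + θ)) * μ (j ⁻¹' D) := by
    have hmul := lintegral_mul_eq_lintegral_mul_lintegral_of_indepFun
      (f := fun ω => expNeg (ENNReal.ofReal (θ * h ω ^ 2))) (g := fun ω => D.indicator 1 (j ω))
      (by fun_prop) ((measurable_one.indicator hD).comp hj)
      (hind.comp (φ := fun a => expNeg (ENNReal.ofReal (θ * a ^ 2))) (ψ := D.indicator 1)
        (by fun_prop) (measurable_one.indicator hD))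
    simp only [Pi.mul_apply] at hmul
    rw [hmul, ← lintegral_map (f := fun a => expNeg (ENNReal.ofReal (θ * a ^ 2))) (by fun_prop) hm, hlaw,
      lintegral_expNeg_mul_sq_rayleighUnit hθ]
    congr 1
    rw [← lintegral_indicator_one (hj hD)]
    rfl
  have h2 : ∫⁻ ω, Dᶜ.indicator 1 (j ω) ∂μ = μ (j ⁻¹' D)ᶜ := by
    rw [← lintegral_indicator_one (hj hD).compl]
    rfl
  have hsplit : ∀ ω, expNeg (if j ω ∈ D then ENNReal.ofReal (θ * h ω ^ 2) else 0)
      = expNeg (ENNReal.ofReal (θ * h ω ^ 2)) * D.indicator 1 (j ω) + Dᶜ.indicator 1 (j ω) := by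
    intro ω
    by_cases hω : j ω ∈ D <;> simp [hω]
  simp_rw [hsplit]
  rw [lintegral_add_right (g := fun ω => Dᶜ.indicator 1 (j ω)) _
    ((measurable_one.indicator hD.compl).comp hj), h1, h2,
    ← ofReal_measureReal, ← ofReal_measureReal, probReal_compl_eq_one_sub (hj hD),
    ← ENNReal.ofReal_mul (by positivity), ← ENNReal.ofReal_add (by positivity)
      (sub_nonneg.2 measureReal_le_one)]
  congr 1
  field_simp
  ring

end marks

/-! ### The success probability given the locations -/

section measurability

lemma measurable_sInf_nat {α : Type*} [MeasurableSpace α] {p : ℕ → α → Prop}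
    (hp : ∀ n, MeasurableSet {x | p n x}) : Measurable fun x => sInf {n | p n x} := by
  refine measurable_to_countable' fun k => ?_
  have : (fun x => sInf {n | p n x}) ⁻¹' {k}
      = ({x | p k x} ∩ ⋂ j, ⋂ (_ : j < k), {x | p j x}ᶜ) ∪ ({_x | k = 0} ∩ ⋂ j, {x | p j x}ᶜ) := by
    ext x
    simp only [Set.mem_preimage, Set.mem_singleton_iff, Set.mem_union, Set.mem_inter_iff,
      Set.mem_iInter, Set.mem_compl_iff, Set.mem_ofPred_eq]
    constructor
    · rintro rfl
      by_cases h : ∃ j, p j x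
      · exact Or.inl ⟨Nat.sInf_mem (s := {n | p n x}) h, fun j hj => Nat.notMem_of_lt_sInf hj⟩
      · push Not at h
        exact Or.inr ⟨by simp [h], h⟩
    · rintro (⟨h, hlt⟩ | ⟨rfl, h⟩)
      · refine le_antisymm (Nat.sInf_le h) (not_lt.1 fun hj => ?_)
        exact hlt _ hj (Nat.sInf_mem (s := {n | p n x}) ⟨k, h⟩)
      · simp [h]
  rw [this]
  refine ((hp k).inter (MeasurableSet.iInter fun j => MeasurableSet.iInter fun _ =>
    (hp j).compl)).union ((MeasurableSet.const _).inter
      (MeasurableSet.iInter fun j => (hp j).compl))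

@[fun_prop] lemma measurable_servingIndex : Measurable servingIndex := by
  refine measurable_sInf_nat fun n => ?_
  simp only [Set.ofPred_forall]
  exact MeasurableSet.iInter fun m => measurableSet_le (by fun_prop) (by fun_prop)

lemma measurable_eval_nat {γ : Type*} [MeasurableSpace γ] :
    Measurable fun q : ℕ × (ℕ → γ) => q.2 q.1 :=
  measurable_from_prod_countable_right fun n => measurable_pi_apply n

@[fun_prop] lemma measurable_servingDist : Measurable servingDist :=
  (measurable_eval_nat.comp (measurable_servingIndex.prodMk measurable_id)).norm

lemma measurable_sinr {N : ℕ} (P β Rb s2 : ℝ) (S : Finset (Fin N)) :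
    Measurable fun q : (ℕ → EuclideanSpace ℝ (Fin 2)) × (ℕ → ℝ × Fin N) =>
      sinr P β Rb s2 S q.1 (fun n => (q.2 n).1) (fun n => (q.2 n).2) := by
  have hidx : Measurable fun q : (ℕ → EuclideanSpace ℝ (Fin 2)) × (ℕ → ℝ × Fin N) =>
      (q.2 (servingIndex q.1)).1 :=
    measurable_fst.comp (measurable_eval_nat.comp
      ((measurable_servingIndex.comp measurable_fst).prodMk measurable_snd))
  have hdist : Measurable fun q : (ℕ → EuclideanSpace ℝ (Fin 2)) × (ℕ → ℝ × Fin N) =>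
      servingDist q.1 := measurable_servingDist.comp measurable_fst
  have hI : Measurable fun q : (ℕ → EuclideanSpace ℝ (Fin 2)) × (ℕ → ℝ × Fin N) =>
      interference P β Rb S q.1 (fun n => (q.2 n).1) (fun n => (q.2 n).2) := by
    refine Measurable.tsum fun n => Measurable.ite ?_ ?_ measurable_const
    · refine measurableSet_lt (Measurable.ite ?_ (by fun_prop) hdist) (by fun_prop)
      have : Measurable fun q : (ℕ → EuclideanSpace ℝ (Fin 2)) × (ℕ → ℝ × Fin N) =>
        (q.2 n).2 := by fun_prop
      exact this (Set.toFinite (S : Set (Fin N))).measurableSet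
    · unfold rxPower
      fun_prop
  unfold sinr rxPower
  simp only [div_eq_mul_inv]
  fun_prop

end measurability

/-- In area coordinates, `blockProb` is `θ / (1 + θ)` for the ratio `θ` of the received powers of an
interferer and of the signal, times the threshold. -/
lemma blockProb_area {s β c R d : ℝ} (hc : 0 < c) (hR : 0 < R) (hd : 0 < d) :
    blockProb s (β / 2) (c * R ^ 2) (c * d ^ 2)
      = s * R ^ β * d ^ (-β) / (1 + s * R ^ β * d ^ (-β)) := by
  have hpow : ∀ r : ℝ, 0 < r → (c * r ^ 2) ^ (β / 2) = c ^ (β / 2) * r ^ β := fun r hr => by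
    rw [Real.mul_rpow hc.le (by positivity), ← Real.rpow_natCast_mul hr.le]
    congr 2
    push_cast
    ring
  have hc' : 0 < c ^ (β / 2) := Real.rpow_pos_of_pos hc _
  have hd' : 0 < d ^ β := Real.rpow_pos_of_pos hd _
  rw [blockProb, hpow R hR, hpow d hd, Real.rpow_neg hd.le]
  have h1 : s * (c ^ (β / 2) * R ^ β) + c ^ (β / 2) * d ^ β
      = c ^ (β / 2) * d ^ β * (1 + s * R ^ β * (d ^ β)⁻¹) := by
    field_simp
    ring
  have h2 : s * (c ^ (β / 2) * R ^ β) = c ^ (β / 2) * d ^ β * (s * R ^ β * (d ^ β)⁻¹) := by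
    field_simp
  rw [h1, h2, mul_div_mul_left _ _ (by positivity)]

/-- The total attenuation of the serving signal by the stations at the locations `x`, when a station
beyond the cancellation radius `Rb` always interferes, and one within it with probability `ρ`. -/
noncomputable def residualAttenuation (s β c ρ Rb : ℝ) (x : ℕ → EuclideanSpace ℝ (Fin 2)) : ℝ≥0∞ :=
  ∑' n, if servingDist x < ‖x n‖ then attenuation ((if Rb < ‖x n‖ then 1 else ρ)
    * blockProb s (β / 2) (c * servingDist x ^ 2) (c * ‖x n‖ ^ 2)) else 0

@[fun_prop] lemma measurable_residualAttenuation (s β c ρ Rb : ℝ) :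
    Measurable (residualAttenuation s β c ρ Rb) := by
  refine Measurable.tsum fun n => Measurable.ite (measurableSet_lt (by fun_prop) (by fun_prop))
    (measurable_attenuation.comp (Measurable.mul (Measurable.ite
      (measurableSet_lt (by fun_prop) (by fun_prop)) measurable_const measurable_const) ?_))
    measurable_const
  exact measurable_blockProb.comp (Measurable.prodMk (by fun_prop) (by fun_prop))

lemma le_sinr_iff {N : ℕ} {P β Rb s s2 : ℝ} (hP : 0 < P) (hs : 0 < s) (hs2 : 0 < s2)
    {S : Finset (Fin N)} {x : ℕ → EuclideanSpace ℝ (Fin 2)} (hR : 0 < servingDist x)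
    (h : ℕ → ℝ) (t : ℕ → Fin N) :
    s ≤ sinr P β Rb s2 S x h t ↔
      ENNReal.ofReal (s * servingDist x ^ β / P) * interference P β Rb S x h t
        + ENNReal.ofReal (s * servingDist x ^ β / P * s2)
        ≤ ENNReal.ofReal (h (servingIndex x) ^ 2) := by
  have hD : interference P β Rb S x h t + ENNReal.ofReal s2 ≠ 0 := by simp [hs2]
  have hR' : 0 < servingDist x ^ β := Real.rpow_pos_of_pos hR β
  have hk : 0 < servingDist x ^ β / P := by positivity
  rw [sinr, ← ENNReal.ofReal_le_iff_le_toReal (ENNReal.div_ne_top ENNReal.ofReal_ne_top hD),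
    ENNReal.le_div_iff_mul_le (Or.inl hD) (Or.inr ENNReal.ofReal_ne_top),
    ← ENNReal.mul_le_mul_iff_right (ENNReal.ofReal_pos.2 hk).ne' ENNReal.ofReal_ne_top,
    ← mul_assoc, ← ENNReal.ofReal_mul hk.le, ← ENNReal.ofReal_mul hk.le, mul_add,
    ← ENNReal.ofReal_mul (by positivity)]
  have h1 : servingDist x ^ β / P * rxPower P β (servingDist x) (h (servingIndex x))
      = h (servingIndex x) ^ 2 := by
    rw [rxPower, Real.rpow_neg hR.le]
    field_simp
  rw [h1, show servingDist x ^ β / P * s = s * servingDist x ^ β / P by ring]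

namespace IsDownlink

variable {Ω : Type*} [MeasurableSpace Ω] {N : ℕ} {μ : Measure Ω} [IsProbabilityMeasure μ]
  {lam : ℝ} {α : Fin N → ℝ} {X : ℕ → Ω → EuclideanSpace ℝ (Fin 2)} {H : ℕ → Ω → ℝ}
  {J : ℕ → Ω → Fin N}

/-- The Laplace transform of the normalized received power of one potential interferer. -/
lemma lintegral_expNeg_interferer (hnet : IsDownlink μ lam α X H J) {S : Finset (Fin N)} {ρ : ℝ}
    (hρ : ∀ n, μ.real {ω | J n ω ∉ S} = ρ) {P β Rb s c R d : ℝ} (hP : 0 < P) (hs : 0 < s)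
    (hc : 0 < c) (hR : 0 < R) (n : ℕ) :
    ∫⁻ ω, expNeg (ENNReal.ofReal (s * R ^ β / P)
        * if (if J n ω ∈ S then max R Rb else R) < d then ENNReal.ofReal (rxPower P β d (H n ω))
          else 0) ∂μ
      = expNeg (if R < d then attenuation ((if Rb < d then 1 else ρ)
          * blockProb s (β / 2) (c * R ^ 2) (c * d ^ 2)) else 0) := by
  by_cases hd : R < d
  swap
  · rw [if_neg hd]
    have : ∀ ω, ¬ (if J n ω ∈ S then max R Rb else R) < d := fun ω => by
      split_ifs
      · exact fun h => hd ((le_max_left _ _).trans_lt h)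
      · exact hd
    simp [this]
  have hd0 : 0 < d := hR.trans hd
  have hR' : 0 < R ^ β := Real.rpow_pos_of_pos hR β
  have hd' : 0 < d ^ (-β) := Real.rpow_pos_of_pos hd0 _
  let D : Set (Fin N) := {j | (if j ∈ S then max R Rb else R) < d}
  have hmem : ∀ j, j ∈ D ↔ (if j ∈ S then max R Rb else R) < d := fun j => Iff.rfl
  have hDm : MeasurableSet D := (Set.toFinite D).measurableSet
  classical
  have hlap := lintegral_expNeg_ite_rayleigh (hnet.measurable_fading n) (hnet.measurable_packet n)
    (hnet.law_fading n) (hnet.indep_fading_packet n) hDm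
    (θ := s * R ^ β * d ^ (-β)) (by positivity)
  have hprob : μ.real (J n ⁻¹' D) = if Rb < d then 1 else ρ := by
    split_ifs with hRb
    · have : J n ⁻¹' D = Set.univ := by
        ext ω
        rw [Set.mem_preimage, hmem]
        split_ifs <;> simp [hd, hRb]
      rw [this, probReal_univ]
    · rw [← hρ n]
      congr 1
      ext ω
      rw [Set.mem_preimage, hmem, Set.mem_ofPred_eq]
      split_ifs with h <;> simp [hd, h, hRb]
  have hρ0 : 0 ≤ ρ := by rw [← hρ n]; exact measureReal_nonneg
  have hρ1 : ρ ≤ 1 := by rw [← hρ n]; exact measureReal_le_one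
  have hq0 := blockProb_nonneg (b := β / 2) hs (u := c * R ^ 2) (v := c * d ^ 2) (by positivity)
    (by positivity)
  have hq1 := blockProb_lt_one (b := β / 2) hs (u := c * R ^ 2) (v := c * d ^ 2) (by positivity)
    (by positivity)
  rw [hprob, ← blockProb_area hc hR hd0] at hlap
  rw [if_pos hd, expNeg_attenuation, ← hlap]
  · refine lintegral_congr fun ω => ?_
    congr 1
    simp only [hmem]
    split_ifs
    all_goals first
      | exact mul_zero _
      | rw [← ENNReal.ofReal_mul (by positivity), rxPower]
        congr 1
        field_simp
  · split_ifs <;> positivity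
  · split_ifs <;> nlinarith

/-- The success probability given the locations of the stations. -/
lemma measure_le_sinr (hnet : IsDownlink μ lam α X H J) {S : Finset (Fin N)} {ρ : ℝ}
    (hρ : ∀ n, μ.real {ω | J n ω ∉ S} = ρ) {P β Rb s s2 c : ℝ} (hP : 0 < P) (hs : 0 < s)
    (hs2 : 0 < s2) (hc : 0 < c) {x : ℕ → EuclideanSpace ℝ (Fin 2)} (hR : 0 < servingDist x) :
    μ {ω | s ≤ sinr P β Rb s2 S x (fun n => H n ω) (fun n => J n ω)}
      = expNeg (residualAttenuation s β c ρ Rb x)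
        * expNeg (ENNReal.ofReal (s * servingDist x ^ β / P * s2)) := by
  obtain ⟨k, hk⟩ : ∃ k, k = servingIndex x := ⟨_, rfl⟩
  let φ : ℕ → ℝ × Fin N → ℝ≥0∞ := fun n z => ENNReal.ofReal (s * servingDist x ^ β / P)
    * if (if z.2 ∈ S then max (servingDist x) Rb else servingDist x) < ‖x n‖
      then ENNReal.ofReal (rxPower P β ‖x n‖ z.1) else 0
  have hφ : ∀ n, Measurable (φ n) := fun n => by
    refine Measurable.const_mul (Measurable.ite ?_ ?_ measurable_const) _
    · exact (measurable_snd : Measurable (Prod.snd : ℝ × Fin N → Fin N))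
        (Set.toFinite {j : Fin N | (if j ∈ S then max (servingDist x) Rb else servingDist x)
          < ‖x n‖}).measurableSet
    · unfold rxPower
      fun_prop
  have hmark : ∀ n, Measurable fun ω => (H n ω, J n ω) := fun n =>
    (hnet.measurable_fading n).prodMk (hnet.measurable_packet n)
  -- the serving station is at distance exactly `servingDist x`, hence does not interfere
  have hφk : ∀ z, φ k z = 0 := fun z => by
    have : ¬ (if z.2 ∈ S then max (servingDist x) Rb else servingDist x) < ‖x k‖ := by
      rw [hk, show ‖x (servingIndex x)‖ = servingDist x from rfl]
      split_ifs <;> simp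
    simp [φ, this]
  have hind := indepFun_tsum hnet.indep_stations hmark hφ hφk
  have hind' := hind.comp (φ := Prod.fst)
    (ψ := fun y => y + ENNReal.ofReal (s * servingDist x ^ β / P * s2)) measurable_fst
    (by fun_prop)
  have hYm : Measurable fun ω => ∑' n, φ n (H n ω, J n ω) :=
    Measurable.tsum fun n => (hφ n).comp (hmark n)
  have hmain := measure_le_sq_of_indepFun (hnet.measurable_fading k) (hYm.add_const _)
    (hnet.law_fading k) hind'
  have hset : ∀ ω, s ≤ sinr P β Rb s2 S x (fun n => H n ω) (fun n => J n ω) ↔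
      ∑' n, φ n (H n ω, J n ω) + ENNReal.ofReal (s * servingDist x ^ β / P * s2)
        ≤ ENNReal.ofReal (H k ω ^ 2) := fun ω => by
    rw [le_sinr_iff hP hs hs2 hR, interference, ← ENNReal.tsum_mul_left, hk]
  simp_rw [hset]
  rw [hmain]
  simp_rw [expNeg_add]
  rw [lintegral_mul_const _ (by fun_prop)]
  congr 1
  refine lintegral_expNeg_tsum_of_iIndepFun (hnet.indep_stations.comp φ hφ)
    (fun n => (hφ n).comp (hmark n)) fun n => ?_
  exact hnet.lintegral_expNeg_interferer hρ hP hs hc hR n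

end IsDownlink

/-! ### The closed form -/

/-- The change of variables `v = t ^ (-2 / β)` in Euler's integral. -/
lemma Z₁_eq_blockRate {β x : ℝ} (hβ : 2 < β) : Z₁ β x = blockRate x (β / 2) := by
  have hβ0 : 0 < β := by linarith
  have hb : 0 < 1 - 2 / β := by rw [sub_pos, div_lt_one hβ0]; exact hβ
  have hΓ : Real.Gamma (2 - 2 / β) = (1 - 2 / β) * Real.Gamma (1 - 2 / β) := by
    rw [← Real.Gamma_add_one hb.ne']; congr 1; ring
  have hΓ0 : Real.Gamma (1 - 2 / β) ≠ 0 := (Real.Gamma_pos_of_pos hb).ne'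
  have himage : (fun t : ℝ => t ^ (-2 / β)) '' Set.Ioo 0 1 = Set.Ioi 1 := by
    ext v
    constructor
    · rintro ⟨t, ⟨h0, h1⟩, rfl⟩
      exact Real.one_lt_rpow_of_pos_of_lt_one_of_neg h0 h1 (div_neg_of_neg_of_pos (by norm_num) hβ0)
    · intro (hv : 1 < v)
      have hv0 : 0 < v := one_pos.trans hv
      refine ⟨v ^ (-β / 2), ⟨Real.rpow_pos_of_pos hv0 _,
        Real.rpow_lt_one_of_one_lt_of_neg hv (by linarith)⟩, ?_⟩
      simp only
      rw [← Real.rpow_mul hv0.le, show -β / 2 * (-2 / β) = 1 by field_simp, Real.rpow_one]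
  have hinj : Set.InjOn (fun t : ℝ => t ^ (-2 / β)) (Set.Ioo 0 1) :=
    (Real.rpow_left_injOn (by
      exact (div_neg_of_neg_of_pos (by norm_num) hβ0).ne)).mono fun t ht => ht.1.le
  have hsubst := integral_image_eq_integral_abs_deriv_smul measurableSet_Ioo
    (fun t ht => (Real.hasDerivAt_rpow_const (p := -2 / β) (Or.inl ht.1.ne')).hasDerivWithinAt)
    hinj (fun v => x / (x + v ^ (β / 2)))
  rw [himage] at hsubst
  rw [blockRate, hsubst, Z₁, gaussHyp, hΓ, show 2 - 2 / β - (1 - 2 / β) = 1 by ring,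
    Real.Gamma_one, mul_one, mul_div_cancel_right₀ _ hΓ0, ← mul_assoc,
    intervalIntegral.integral_of_le zero_le_one, integral_Ioc_eq_integral_Ioo,
    ← integral_const_mul]
  refine setIntegral_congr_fun measurableSet_Ioo fun t ht => ?_
  have ht0 : 0 < t := ht.1
  have hpow : (t ^ (-2 / β)) ^ (β / 2) = t⁻¹ := by
    rw [← Real.rpow_mul ht0.le, show -2 / β * (β / 2) = -1 by field_simp, Real.rpow_neg_one]
  have habs : |-2 / β * t ^ (-2 / β - 1)| = 2 / β * (t ^ (-2 / β) * t⁻¹) := by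
    rw [abs_mul, abs_of_neg (div_neg_of_neg_of_pos (by norm_num) hβ0),
      abs_of_pos (Real.rpow_pos_of_pos ht0 _), Real.rpow_sub ht0, Real.rpow_one, neg_div, neg_neg,
      ← div_eq_mul_inv]
  simp only [smul_eq_mul]
  rw [habs, hpow, sub_self, Real.rpow_zero, mul_one, Real.rpow_neg_one,
    show 1 - 2 / β - 1 = -2 / β by ring, show x + t⁻¹ = t⁻¹ * (1 - -x * t) by field_simp; ring,
    div_eq_mul_inv x, mul_inv, inv_inv]
  have h2 : β - 2 ≠ 0 := by linarith
  field_simp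

lemma blockRate_pos {s b : ℝ} (hs : 0 < s) (hb : 1 < b) : 0 < blockRate s b := by
  have hpos : ∀ v ∈ Set.Ioi (1 : ℝ), 0 < s / (s + v ^ b) := fun v (hv : 1 < v) => by
    have : 0 < v := one_pos.trans hv
    positivity
  have hint : IntegrableOn (fun v : ℝ => s / (s + v ^ b)) (Set.Ioi 1) := by
    refine (integrableOn_blockProb hs hb zero_le_one one_pos).congr_fun (fun v hv => ?_)
      measurableSet_Ioi
    simp [blockProb]
  rw [blockRate, setIntegral_pos_iff_support_of_nonneg_ae
    ((ae_restrict_mem measurableSet_Ioi).mono fun v hv => (hpos v hv).le) hint,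
    Set.inter_eq_right.2 fun v hv => Function.mem_support.2 (hpos v hv).ne']
  simp

/-! ### Limit of the loss rate -/

lemma attenuation_blockProb_le {s b u v : ℝ} (hs : 0 < s) (hu : 0 ≤ u) (hv : 0 < v) :
    attenuation (blockProb s b u v) ≤ ENNReal.ofReal (s * u ^ b) * ENNReal.ofReal (v ^ (-b)) := by
  have hv' : 0 < v ^ b := Real.rpow_pos_of_pos hv b
  have hu' : 0 ≤ u ^ b := Real.rpow_nonneg hu b
  rw [← ENNReal.ofReal_mul (by positivity), Real.rpow_neg hv.le, attenuation]
  refine ENNReal.ofReal_le_ofReal ?_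
  have h1 : 1 - blockProb s b u v = (1 + s * u ^ b * (v ^ b)⁻¹)⁻¹ := by
    unfold blockProb
    field_simp
    ring
  rw [h1, Real.log_inv, neg_neg]
  have := Real.log_le_sub_one_of_pos (x := 1 + s * u ^ b * (v ^ b)⁻¹) (by positivity)
  linarith

lemma threshold_pos {T τ B : ℝ} (hT : 0 < T) (hτ : 0 < τ) (hB : 0 < B) : 0 < threshold T τ B := by
  rw [threshold, sub_pos]
  exact Real.one_lt_rpow one_lt_two (by positivity)

lemma rate_lt_iff {T τ B y : ℝ} (hτ : 0 < τ) (hB : 0 < B) (hy : 0 ≤ y) :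
    τ * B * Real.logb 2 (1 + y) < T ↔ ¬ threshold T τ B ≤ y := by
  rw [mul_comm, ← lt_div_iff₀ (by positivity), Real.logb_lt_iff_lt_rpow one_lt_two (by linarith),
    not_le, threshold, lt_sub_iff_add_lt']

namespace IsDownlink

variable {Ω : Type*} [MeasurableSpace Ω] {N : ℕ} {μ : Measure Ω} [IsProbabilityMeasure μ]
  {lam : ℝ} {α : Fin N → ℝ} {X : ℕ → Ω → EuclideanSpace ℝ (Fin 2)} {H : ℕ → Ω → ℝ}
  {J : ℕ → Ω → Fin N}

lemma ae_servingDist (hnet : IsDownlink μ lam α X H J) (hlam : 0 < lam) :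
    ∀ᵐ ω ∂μ, 0 < servingDist (fun n => X n ω) ∧ ∀ n, servingDist (fun n => X n ω) ≤ ‖X n ω‖ := by
  have hc : 0 < Real.pi * lam := mul_pos Real.pi_pos hlam
  have hV := hnet.poisson.area hlam
  filter_upwards [hV.ae_pos, hV.ae_exists_forall_le] with ω hpos ⟨k, hk⟩
  have hmem : servingIndex (fun n => X n ω) ∈ {n | ∀ m, ‖X n ω‖ ≤ ‖X m ω‖} :=
    Nat.sInf_mem ⟨k, fun m => le_of_sq_le_sq (le_of_mul_le_mul_left (hk m) hc) (norm_nonneg _)⟩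
  refine ⟨(norm_nonneg _).lt_of_ne fun h => ?_, hmem⟩
  have := hpos (servingIndex fun n => X n ω)
  rw [← h] at this
  simp at this

/-- The loss rate for positive noise and a finite cancellation radius. -/
lemma lossRate_eq (hnet : IsDownlink μ lam α X H J) (hlam : 0 < lam) {M : ℕ} {S : Scheme N M}
    {ρ : ℝ} (hρ : ∀ n, μ.real {ω | J n ω ∉ S.1} = ρ) {P β T τ B Rb s2 : ℝ} (hP : 0 < P)
    (hT : 0 < T) (hτ : 0 < τ) (hB : 0 < B) (hs2 : 0 < s2) :
    lossRate μ X H J P β T τ B Rb s2 S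
      = 1 - (∫⁻ ω, expNeg (residualAttenuation (threshold T τ B) β (Real.pi * lam) ρ Rb
            fun n => X n ω) * expNeg (ENNReal.ofReal
              (threshold T τ B * servingDist (fun n => X n ω) ^ β / P * s2)) ∂μ).toReal := by
  obtain ⟨s, hs⟩ : ∃ s, s = threshold T τ B := ⟨_, rfl⟩
  have hs0 : 0 < s := hs ▸ threshold_pos hT hτ hB
  have hXm : Measurable fun ω n => X n ω := measurable_pi_lambda _ hnet.poisson.measurable
  have hZm : Measurable fun ω n => (H n ω, J n ω) := measurable_pi_lambda _ fun n =>
    (hnet.measurable_fading n).prodMk (hnet.measurable_packet n)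
  let A : Set ((ℕ → EuclideanSpace ℝ (Fin 2)) × (ℕ → ℝ × Fin N)) :=
    {q | s ≤ sinr P β Rb s2 S.1 q.1 (fun n => (q.2 n).1) (fun n => (q.2 n).2)}
  have hA : MeasurableSet A := measurableSet_le measurable_const (measurable_sinr P β Rb s2 S.1)
  have hpair : Measurable fun ω => ((fun n => X n ω), fun n => (H n ω, J n ω)) := hXm.prodMk hZm
  have hloss : lossRate μ X H J P β T τ B Rb s2 S
      = μ.real ((fun ω => ((fun n => X n ω), fun n => (H n ω, J n ω))) ⁻¹' A)ᶜ := by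
    rw [lossRate]
    congr 1
    ext ω
    rw [Set.mem_ofPred_eq, rate_lt_iff hτ hB (by unfold sinr; exact ENNReal.toReal_nonneg), ← hs]
    rfl
  have hprobX : IsProbabilityMeasure (μ.map fun ω n => X n ω) :=
    Measure.isProbabilityMeasure_map hXm.aemeasurable
  have hprobZ : IsProbabilityMeasure (μ.map fun ω n => (H n ω, J n ω)) :=
    Measure.isProbabilityMeasure_map hZm.aemeasurable
  rw [hloss, probReal_compl_eq_one_sub (hpair hA), measureReal_def, ← Measure.map_apply hpair hA,
    hnet.indep_locations.map_prod_eq_prod_map_map hXm.aemeasurable hZm.aemeasurable,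
    Measure.prod_apply hA, lintegral_map (measurable_measure_prodMk_left hA) hXm, ← hs]
  congr 2
  refine lintegral_congr_ae ?_
  filter_upwards [hnet.ae_servingDist hlam] with ω hω
  rw [Measure.map_apply hZm (measurable_prodMk_left hA)]
  exact hnet.measure_le_sinr hρ hP hs0 hs2 (mul_pos Real.pi_pos hlam) hω.1

/-- As the cancellation radius grows, only the packets that the user has not cached keep
interfering. -/
lemma tendsto_residualAttenuation (hnet : IsDownlink μ lam α X H J) (hlam : 0 < lam) {s β ρ : ℝ}
    (hs : 0 < s) (hβ : 2 < β) (hρ1 : ρ ≤ 1) :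
    ∀ᵐ ω ∂μ, Tendsto (fun Rb => residualAttenuation s β (Real.pi * lam) ρ Rb fun n => X n ω) atTop
      (𝓝 (totalAttenuation s (β / 2) ρ (Real.pi * lam * servingDist (fun n => X n ω) ^ 2)
        fun n => Real.pi * lam * ‖X n ω‖ ^ 2)) := by
  have hc : 0 < Real.pi * lam := mul_pos Real.pi_pos hlam
  have hV := hnet.poisson.area hlam
  filter_upwards [hnet.ae_servingDist hlam, hV.ae_pos,
    hV.ae_tsum_rpow_ne_top (b := β / 2) (by linarith)] with ω ⟨hR, _⟩ hpos hsum
  obtain ⟨R, hRdef⟩ : ∃ R, R = servingDist fun n => X n ω := ⟨_, rfl⟩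
  obtain ⟨c, hcdef⟩ : ∃ c, c = Real.pi * lam := ⟨_, rfl⟩
  simp only [residualAttenuation, totalAttenuation]
  rw [← hRdef] at hR ⊢
  simp only [← hcdef] at hc hpos hsum ⊢
  have hlt : ∀ n, c * R ^ 2 < c * ‖X n ω‖ ^ 2 ↔ R < ‖X n ω‖ := fun n => by
    rw [mul_lt_mul_iff_right₀ hc, sq_lt_sq₀ hR.le (norm_nonneg _)]
  have hu : 0 ≤ c * R ^ 2 := by positivity
  have hbound : ∑' n, (if c * R ^ 2 < c * ‖X n ω‖ ^ 2
      then attenuation (blockProb s (β / 2) (c * R ^ 2) (c * ‖X n ω‖ ^ 2)) else 0) ≠ ∞ := by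
    refine ne_top_of_le_ne_top (ENNReal.mul_ne_top
      (ENNReal.ofReal_ne_top (r := s * (c * R ^ 2) ^ (β / 2))) (hsum (c * R ^ 2) (by positivity))) ?_
    rw [← ENNReal.tsum_mul_left]
    refine ENNReal.tsum_le_tsum fun n => ?_
    split_ifs
    · exact attenuation_blockProb_le hs hu (hpos n)
    · exact zero_le
  have h := tendsto_lintegral_filter_of_dominated_convergence (μ := (Measure.count : Measure ℕ))
    (l := atTop) (F := fun (Rb : ℝ) n => if R < ‖X n ω‖ then
      attenuation ((if Rb < ‖X n ω‖ then 1 else ρ)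
        * blockProb s (β / 2) (c * R ^ 2) (c * ‖X n ω‖ ^ 2)) else 0)
    (f := fun n => if c * R ^ 2 < c * ‖X n ω‖ ^ 2 then
      attenuation (ρ * blockProb s (β / 2) (c * R ^ 2) (c * ‖X n ω‖ ^ 2)) else 0)
    (fun n => if c * R ^ 2 < c * ‖X n ω‖ ^ 2
      then attenuation (blockProb s (β / 2) (c * R ^ 2) (c * ‖X n ω‖ ^ 2)) else 0)
    (Eventually.of_forall fun _ => measurable_of_countable _)
    (Eventually.of_forall fun Rb => Eventually.of_forall fun n => ?_)
    (by rwa [lintegral_count])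
    (Eventually.of_forall fun n => ?_)
  · simpa only [lintegral_count] using h
  · have h0 := blockProb_nonneg (b := β / 2) hs hu (hpos n)
    have h1 := blockProb_lt_one (b := β / 2) hs hu (hpos n)
    simp only [hlt]
    split_ifs
    · rw [one_mul]
    · exact attenuation_mono (mul_le_of_le_one_left h0 hρ1) h1
    · exact le_rfl
  · refine tendsto_const_nhds.congr' ?_
    filter_upwards [eventually_ge_atTop ‖X n ω‖] with Rb hRb
    simp only [hlt, if_neg (not_lt.2 hRb)]

lemma tendsto_lossRate (hnet : IsDownlink μ lam α X H J) (hlam : 0 < lam) {M : ℕ} {S : Scheme N M}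
    {ρ : ℝ} (hρ : ∀ n, μ.real {ω | J n ω ∉ S.1} = ρ) {P β T τ B : ℝ} (hP : 0 < P) (hβ : 2 < β)
    (hT : 0 < T) (hτ : 0 < τ) (hB : 0 < B) :
    Tendsto (fun v : ℝ × ℝ => lossRate μ X H J P β T τ B v.1 v.2 S) (atTop ×ˢ 𝓝[>] 0)
      (𝓝 (1 - 1 / (1 + ρ * Z₁ β (threshold T τ B)))) := by
  obtain ⟨s, hsdef⟩ : ∃ s, s = threshold T τ B := ⟨_, rfl⟩
  have hs : 0 < s := hsdef ▸ threshold_pos hT hτ hB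
  have hc : 0 < Real.pi * lam := mul_pos Real.pi_pos hlam
  have hρ0 : 0 ≤ ρ := by rw [← hρ 0]; exact measureReal_nonneg
  have hρ1 : ρ ≤ 1 := by rw [← hρ 0]; exact measureReal_le_one
  have hκ := mul_nonneg hρ0 (blockRate_nonneg (b := β / 2) hs)
  have hXm : Measurable fun ω n => X n ω := measurable_pi_lambda _ hnet.poisson.measurable
  have hU : ∀ᵐ ω ∂μ, 0 < Real.pi * lam * servingDist (fun n => X n ω) ^ 2 ∧
      (∃ k, Real.pi * lam * ‖X k ω‖ ^ 2 = Real.pi * lam * servingDist (fun n => X n ω) ^ 2) ∧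
      ∀ n, Real.pi * lam * servingDist (fun n => X n ω) ^ 2 ≤ Real.pi * lam * ‖X n ω‖ ^ 2 := by
    filter_upwards [hnet.ae_servingDist hlam] with ω hω
    have := hω.1
    refine ⟨by positivity, ⟨servingIndex fun n => X n ω, rfl⟩, fun n => ?_⟩
    have := hω.2 n
    gcongr
  have hsnd : Tendsto (fun v : ℝ × ℝ => v.2) (atTop ×ˢ 𝓝[>] 0) (𝓝 0) :=
    tendsto_snd.mono_right nhdsWithin_le_nhds
  have hlim : Tendsto (fun v : ℝ × ℝ =>
      ∫⁻ ω, expNeg (residualAttenuation s β (Real.pi * lam) ρ v.1 fun n => X n ω)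
        * expNeg (ENNReal.ofReal (s * servingDist (fun n => X n ω) ^ β / P * v.2)) ∂μ)
      (atTop ×ˢ 𝓝[>] 0) (𝓝 (ENNReal.ofReal (1 / (1 + ρ * blockRate s (β / 2))))) := by
    rw [← (hnet.poisson.area hlam).lintegral_totalAttenuation hU hs (by linarith : 1 < β / 2)
      hρ0 hρ1]
    refine tendsto_lintegral_filter_of_dominated_convergence (fun _ => 1)
      (Eventually.of_forall fun v => ?_)
      (Eventually.of_forall fun v => Eventually.of_forall fun ω =>
        mul_le_one' (expNeg_le_one _) (expNeg_le_one _)) (by simp) ?_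
    · have h1 := (measurable_residualAttenuation s β (Real.pi * lam) ρ v.1).comp hXm
      have h2 := measurable_servingDist.comp hXm
      exact (measurable_expNeg.comp h1).mul (measurable_expNeg.comp (ENNReal.measurable_ofReal.comp
        ((((h2.pow_const β).const_mul s).div_const P).mul_const v.2)))
    · filter_upwards [hnet.tendsto_residualAttenuation hlam hs hβ hρ1] with ω hω
      have h1 := (continuous_expNeg.tendsto _).comp (hω.comp
        (tendsto_fst : Tendsto Prod.fst (atTop ×ˢ 𝓝[>] (0 : ℝ)) atTop))
      have h2 : Tendsto (fun v : ℝ × ℝ => expNeg (ENNReal.ofReal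
          (s * servingDist (fun n => X n ω) ^ β / P * v.2))) (atTop ×ˢ 𝓝[>] 0) (𝓝 1) := by
        have h3 := (hsnd.const_mul (s * servingDist (fun n => X n ω) ^ β / P))
        rw [mul_zero] at h3
        have h4 := (continuous_expNeg.tendsto _).comp (ENNReal.tendsto_ofReal h3)
        rw [ENNReal.ofReal_zero, expNeg_zero] at h4
        exact h4
      simpa using ENNReal.Tendsto.mul h1 (Or.inr ENNReal.one_ne_top) h2
        (Or.inr (expNeg_ne_top _))
  have hreal := ((ENNReal.tendsto_toReal ENNReal.ofReal_ne_top).comp hlim).const_sub 1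
  rw [ENNReal.toReal_ofReal (by positivity)] at hreal
  rw [← hsdef, Z₁_eq_blockRate hβ]
  refine hreal.congr' ?_
  have hpos : ∀ᶠ v : ℝ × ℝ in atTop ×ˢ 𝓝[>] 0, 0 < v.2 :=
    tendsto_snd.eventually eventually_mem_nhdsWithin
  filter_upwards [hpos] with v hv
  rw [hnet.lossRate_eq hlam hρ hP hT hτ hB hv, ← hsdef]
  rfl

end IsDownlink

/-! ### Uniform caching -/

section uniform

variable {N M : ℕ}

lemma sum_mul_one_sub_cached {p : Scheme N M → ℝ} (hp_sum : ∑ S, p S = 1) (c : ℝ) (j : Fin N) :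
    ∑ S, p S * (1 - cached S j) * c = (1 - cachingProb p j) * c := by
  simp_rw [← Finset.sum_mul, mul_sub, mul_one]
  rw [Finset.sum_sub_distrib, hp_sum, cachingProb]

lemma sum_one_sub_cached (S : Scheme N M) : ∑ j, (1 - cached S j) = (N : ℝ) - M := by
  simp [cached, Finset.sum_sub_distrib, S.2]

/-- Under uniform caching of equally popular packets, all packets are transmitted equally often. -/
lemma txProb_uniform (hMN : M < N) {p : Scheme N M → ℝ} (hp_sum : ∑ S, p S = 1)
    (hq : ∀ j, cachingProb p j = (M : ℝ) / N) {f : Fin N → ℝ} (hf : ∀ j, f j = 1 / N)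
    (j : Fin N) : txProb p f j = 1 / N := by
  have hN : (0 : ℝ) < N := by exact_mod_cast (Nat.zero_le M).trans_lt hMN
  have hM : (M : ℝ) < N := by exact_mod_cast hMN
  have h : (1 - (M : ℝ) / N) ≠ 0 := by
    rw [sub_ne_zero, ne_comm, Ne, div_eq_one_iff_eq hN.ne']
    exact hM.ne
  simp only [txProb, sum_mul_one_sub_cached hp_sum, hq, hf, Finset.sum_const, Finset.card_univ,
    Fintype.card_fin, nsmul_eq_mul]
  have h' : (N : ℝ) - M ≠ 0 := sub_ne_zero.2 hM.ne'
  field_simp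

end uniform

end CacheNet

theorem proposition1 {Ω : Type*} [MeasurableSpace Ω] (μ : Measure Ω) [IsProbabilityMeasure μ]
    (N M : ℕ) (hMN : M < N)
    (p : CacheNet.Scheme N M → ℝ) (hp : ∀ S, 0 ≤ p S) (hp_sum : ∑ S, p S = 1)
    (hq : ∀ j, CacheNet.cachingProb p j = (M : ℝ) / N)
    (f : Fin N → ℝ) (hf_sum : ∑ j, f j = 1) (hf : ∀ j k, f j = f k)
    (lam P β T τ B : ℝ) (hlam : 0 < lam) (hP : 0 < P) (hβ : 2 < β)
    (hT : 0 < T) (hτ : 0 < τ) (hB : 0 < B)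
    (X : ℕ → Ω → EuclideanSpace ℝ (Fin 2)) (H : ℕ → Ω → ℝ) (J : ℕ → Ω → Fin N)
    (hnet : CacheNet.IsDownlink μ lam (CacheNet.txProb p f) X H J) :
    Tendsto (fun v : ℝ × ℝ => CacheNet.avgLossRate μ X H J p f P β T τ B v.1 v.2)
      (atTop ×ˢ 𝓝[>] 0)
      (𝓝 ((1 - (M : ℝ) / N) ^ 2 /
        ((1 + (CacheNet.Z₁ β (CacheNet.threshold T τ B))⁻¹) - (M : ℝ) / N))) := by
  have hN : (0 : ℝ) < N := by exact_mod_cast (Nat.zero_le M).trans_lt hMN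
  have hM : (M : ℝ) < N := by exact_mod_cast hMN
  have hfN : ∀ j, f j = 1 / N := fun j => by
    have h := hf_sum
    rw [Finset.sum_congr rfl fun k _ => hf k j, Finset.sum_const, Finset.card_univ,
      Fintype.card_fin, nsmul_eq_mul] at h
    rw [eq_div_iff hN.ne', mul_comm, h]
  have hρ : ∀ (S : CacheNet.Scheme N M) n, μ.real {ω | J n ω ∉ S.1} = 1 - (M : ℝ) / N := by
    intro S n
    have hm : ∀ j, MeasurableSet {ω | J n ω = j} := fun j =>
      hnet.measurable_packet n (measurableSet_singleton j)
    have hunion : {ω | J n ω ∉ S.1} = (⋃ j ∈ S.1, {ω | J n ω = j})ᶜ := by ext ω; simp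
    rw [hunion, probReal_compl_eq_one_sub (S.1.measurableSet_biUnion fun j _ => hm j),
      measureReal_biUnion_finset (fun i _ j _ hij => Set.disjoint_left.2 fun ω hi hj =>
        hij (hi.symm.trans hj)) fun j _ => hm j,
      Finset.sum_congr rfl fun j _ => (hnet.law_packet n j).trans
        (CacheNet.txProb_uniform hMN hp_sum hq hfN j),
      Finset.sum_const, S.2, nsmul_eq_mul, mul_one_div]
  have hlim := tendsto_finsetSum (Finset.univ : Finset (CacheNet.Scheme N M)) fun S _ =>
    (tendsto_finsetSum (Finset.univ : Finset (Fin N)) fun j _ =>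
      ((hnet.tendsto_lossRate hlam (hρ S) hP hβ hT hτ hB).const_mul
        (1 - CacheNet.cached S j)).mul_const (f j)).const_mul (p S)
  refine (hlim.congr fun v => rfl).trans_eq ?_
  have hZ : 0 < CacheNet.Z₁ β (CacheNet.threshold T τ B) := by
    rw [CacheNet.Z₁_eq_blockRate hβ]
    exact CacheNet.blockRate_pos (CacheNet.threshold_pos hT hτ hB) (by linarith)
  have hm : 0 < 1 - (M : ℝ) / N := by rw [sub_pos, div_lt_one hN]; exact hM
  simp only [hfN, ← Finset.sum_mul, CacheNet.sum_one_sub_cached, hp_sum, one_mul]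
  congr 1
  have h1 : ((N : ℝ) - M) = N * (1 - M / N) := by field_simp
  rw [h1]
  obtain ⟨m, hmdef⟩ : ∃ m, m = 1 - (M : ℝ) / N := ⟨_, rfl⟩
  rw [add_sub_right_comm, ← hmdef]
  rw [← hmdef] at hm
  field_simp
  ring
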